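/- Let $1<p<\infty$, $p_*=p/(p-1)$, $q=\max\{p,2\}$, $L>0$, $1<\kappa\le 2$, $\epsilon>0$, and let $f:\mathbb R^d\to\mathbb R$ be convex and $(L,\kappa)$-weakly smooth w.r.t. $\|\cdot\|_p$, i.e. differentiable with $\|\nabla f(x)-\nabla f(y)\|_{p_*}\le L\|x-y\|_p^{\kappa-1}$ for all $x,y$. Let $x^*$ be a minimizer of $f$, let $x_0\ne x^*$, and put $R=\|x^*-x_0\|_p$. Let $\psi_p(x)=\frac{1}{2(p-1)}\|x-x_0\|_p^2$ if $p\le 2$, $\psi_p(x)=\frac1p\|x-x_0\|_p^p$ if $p>2$, and let $\lambda=\frac{\epsilon(p-1)}{2R}$ if $p\le 2$, $\lambda=\frac{\epsilon}{2R^{p-1}}$ if $p>2$. Consider Generalized AGD+ started at $x_0$, applied to $f+\lambda\psi_p$ over $\mathbb R^d$ with $\phi=\psi_p$: with $A_k=\sum_{i\le k}a_i$, $$v_k=\operatorname*{argmin}_{u\in\mathbb R^d}\Big\{\sum_{i=0}^k a_i\langle\nabla f(x_i),u-x_i\rangle+A_k\lambda\psi_p(u)+m_0\psi_p(u)\Big\}\quad(k\ge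 0),\qquad y_0=v_0,$$ $$x_k=\tfrac{A_{k-1}}{A_k}y_{k-1}+\tfrac{a_k}{A_k}v_{k-1},\qquad y_k=\tfrac{A_{k-1}}{A_k}y_{k-1}+\tfrac{a_k}{A_k}v_k\quad(k\ge 1),$$ where $a_k>0$, $a_0=1$, $m_0=A_0M_0$, $a_k^q=2^{2-q}\max\{\lambda A_{k-1}^q,\,m_0A_k^{q-1}\}/M_k$ for $k\ge1$, with $M_k=\big[\frac{2(q-\kappa)}{q\kappa\delta_k}\big]^{\frac{q-\kappa}{\kappa}}L^{\frac q\kappa}$ (and $0^0=1$), $\delta_k=\frac{a_k}{A_k}\bar\epsilon$, $\bar\epsilon=\big(\frac\epsilon2\big)^{\frac{\kappa}{\kappa-1}}\frac{\kappa-1}{L^{1/(\kappa-1)}\kappa}$. Then there are an absolute constant $C_0>0$ and constants $C_p>0$ depending only on $p$ such that, for all such data, the algorithm is well defined (parameters and iterates as above exist), and for all such parameters and iterates there is an integer $K\le N$ with $\|\nabla f(y_k)\|_{p_*}\le\epsilon$ for every $k\ge K$, where: * if $1<p\le2$, $N=C_0\max\Big\{1,\Big(\frac{2L}{\epsilon}\Big)^{\frac{\kappa}{(\kappa-1)(3\kappa-2)}}\Big(\frac{\kappa^{2\kappa}}{(\kappa-1)^{2\kappa}}\cdot\frac{R^\kappa}{(p-1)^\kappa}\Big)^{\frac1{3\kappa-2}}\Big\}\log\Big(e+\frac{LR^{\kappa-1}}{(p-1)\epsilon}\Big)$;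 * if $p>2$, $N=C_p\max\Big\{1,\Big(\frac{2LR^{\kappa-1}}{\epsilon}\Big)^{\frac{\kappa(p-1)}{(\kappa-1)(p\kappa-p+\kappa)}}\Big(\frac{\kappa}{\kappa-1}\Big)^{\frac{p}{p\kappa-p+\kappa}}\Big\}\log\Big(e+\frac{LR^{\kappa-1}}{\epsilon}\Big)$. In particular, for $\kappa=2$ the same holds with $N=C_p\max\big\{1,\sqrt{LR/\epsilon}\big\}\log\big(e+\frac{LR}{(p-1)\epsilon}\big)$ if $1<p\le 2$, and with $N=C_p\max\big\{1,(LR/\epsilon)^{\frac{2(p-1)}{p+2}}\big\}\log\big(e+\frac{LR}{\epsilon}\big)$ if $p>2$. -/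

import Mathlib

open Finset

noncomputable section

namespace GenAGD

/-- The `ℓ_p` norm `(∑ |x_i| ^ p) ^ (1 / p)` on `ℝ^d`, for a finite exponent `p`. -/
def lpNorm {d : ℕ} (p : ℝ) (x : Fin d → ℝ) : ℝ :=
  (∑ i, |x i| ^ p) ^ (1 / p)

/-- The conjugate exponent `p / (p - 1)`. -/
def conjExp (p : ℝ) : ℝ := p / (p - 1)

/-- The gradient of `f` at `x`, as the vector of partial derivatives. -/
def grad {d : ℕ} (f : (Fin d → ℝ) → ℝ) (x : Fin d → ℝ) : Fin d → ℝ :=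
  fun i => fderiv ℝ f x (Pi.single i 1)

/-- `f` is `(L, κ)`-weakly smooth with respect to `‖·‖_p`: it is differentiable and its gradient is
`(κ - 1)`-Hölder with constant `L` from `‖·‖_p` to the dual norm `‖·‖_{p_*}`. -/
def WeaklySmooth {d : ℕ} (p L κ : ℝ) (f : (Fin d → ℝ) → ℝ) : Prop :=
  Differentiable ℝ f ∧
    ∀ x y : Fin d → ℝ,
      lpNorm (conjExp p) (grad f x - grad f y) ≤ L * lpNorm p (x - y) ^ (κ - 1)

/-- Partial sums `A_k = a_0 + ⋯ + a_k`. -/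
def partialSum (a : ℕ → ℝ) (k : ℕ) : ℝ := ∑ i ∈ range (k + 1), a i

/-- The function of `u` minimized in iteration `k` of Generalized AGD+:
`∑_{i ≤ k} a_i ⟨∇f(x_i), u - x_i⟩ + A_k ψ(u) + m₀ φ(u)`. -/
def modelFun {d : ℕ} (f ψ φ : (Fin d → ℝ) → ℝ) (m₀ : ℝ) (a : ℕ → ℝ) (x : ℕ → Fin d → ℝ)
    (k : ℕ) (u : Fin d → ℝ) : ℝ :=
  (∑ i ∈ range (k + 1), a i * (grad f (x i) ⬝ᵥ (u - x i))) + partialSum a k * ψ u + m₀ * φ u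

/-- `(x, v, y)` are the iterates of Generalized AGD+ over the feasible set `X`, applied to the
composite objective `f + ψ`, with proximal function `φ`, parameters `m₀` and `a`, started
at `x₀`. -/
structure IsRun {d : ℕ} (X : Set (Fin d → ℝ)) (f ψ φ : (Fin d → ℝ) → ℝ) (m₀ : ℝ) (a : ℕ → ℝ)
    (x₀ : Fin d → ℝ) (x v y : ℕ → Fin d → ℝ) : Prop where
  start_mem : x₀ ∈ X
  start : x 0 = x₀
  y_zero : y 0 = v 0
  v_mem : ∀ k, v k ∈ X
  v_argmin : ∀ k, IsMinOn (modelFun f ψ φ m₀ a x k) X (v k)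
  x_step : ∀ k, x (k + 1) =
    (partialSum a k / partialSum a (k + 1)) • y k + (a (k + 1) / partialSum a (k + 1)) • v k
  y_step : ∀ k, y (k + 1) =
    (partialSum a k / partialSum a (k + 1)) • y k + (a (k + 1) / partialSum a (k + 1)) • v (k + 1)

/-- `M(δ) = [2 (q - κ) / (q κ δ)] ^ ((q - κ) / κ) * L ^ (q / κ)`. For `q = κ` it equals `L`, by the
convention `0 ^ 0 = 1`. -/
def smoothConst (q L κ δ : ℝ) : ℝ :=
  (2 * (q - κ) / (q * κ * δ)) ^ ((q - κ) / κ) * L ^ (q / κ)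

/-- The constant `M_k = M(δ_k)` for `δ_k = (a_k / A_k) * acc`. -/
def stepConst (q L κ acc : ℝ) (a : ℕ → ℝ) (k : ℕ) : ℝ :=
  smoothConst q L κ (a k / partialSum a k * acc)

/-- The parameters of Generalized AGD+ for the target accuracy `acc` in function value, when
`ψ = lam • φ` and `φ` has the `q`-uniform convexity constant `σ`:
`a_0 = A_0 = 1`, `m₀ = A_0 M_0` and
`a_k ^ q = σ * max {lam * A_{k-1} ^ q, m₀ * A_k ^ (q - 1)} / M_k` for `k ≥ 1`. -/
structure IsStepRule (q L κ lam σ acc m₀ : ℝ) (a : ℕ → ℝ) : Prop where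
  pos : ∀ k, 0 < a k
  zero : a 0 = 1
  m_eq : m₀ = partialSum a 0 * stepConst q L κ acc a 0
  step : ∀ k, a (k + 1) ^ q =
    σ * max (lam * partialSum a k ^ q) (m₀ * partialSum a (k + 1) ^ (q - 1)) /
      stepConst q L κ acc a (k + 1)

/-- The regularizer: `‖x - x₀‖_p ^ 2 / (2 (p - 1))` for `p ≤ 2` and `‖x - x₀‖_p ^ p / p`
for `p > 2`. -/
def psi {d : ℕ} (p : ℝ) (x₀ x : Fin d → ℝ) : ℝ :=
  if p ≤ 2 then 1 / (2 * (p - 1)) * lpNorm p (x - x₀) ^ (2 : ℝ)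
  else 1 / p * lpNorm p (x - x₀) ^ p

/-- The regularization parameter, as a function of the distance `R = ‖x* - x₀‖_p`. -/
def regParam (p ε R : ℝ) : ℝ :=
  if p ≤ 2 then ε * (p - 1) / (2 * R) else ε / (2 * R ^ (p - 1))

/-- The accuracy in function value for the regularized objective that corresponds to the accuracy
`ε` in gradient norm: `(ε / 2) ^ (κ / (κ - 1)) * (κ - 1) / (L ^ (1 / (κ - 1)) * κ)`. -/
def valueAcc (L κ ε : ℝ) : ℝ :=
  (ε / 2) ^ (κ / (κ - 1)) * (κ - 1) / (L ^ (1 / (κ - 1)) * κ)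

/-- `(x, v, y)` are the iterates, started at `x₀`, of Generalized AGD+ over `ℝ^d` applied to
`f + lam * ψ_p` with `φ = ψ_p`, where `lam` is tuned to `R = ‖x* - x₀‖_p`. The exponent of uniform
convexity of `ψ_p` is `q = max {p, 2}`, and its constant is `2 ^ (2 - q)` (which is `1` for
`p ≤ 2`). -/
def IsGradRun {d : ℕ} (p L κ ε R : ℝ) (f : (Fin d → ℝ) → ℝ) (x₀ : Fin d → ℝ)
    (x v y : ℕ → Fin d → ℝ) : Prop :=
  ∃ (m₀ : ℝ) (a : ℕ → ℝ),
    IsStepRule (max p 2) L κ (regParam p ε R) (2 ^ (2 - max p 2)) (valueAcc L κ ε) m₀ a ∧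
    IsRun Set.univ f (fun u => regParam p ε R * psi p x₀ u) (psi p x₀) m₀ a x₀ x v y

/-- Generalized AGD+ (with the above parameters) can be run, and every run reaches
`‖∇f(y_k)‖_{p_*} ≤ ε` after at most `N` iterations, and keeps this guarantee afterwards. -/
def ReachesWithin {d : ℕ} (p L κ ε R : ℝ) (f : (Fin d → ℝ) → ℝ) (x₀ : Fin d → ℝ) (N : ℝ) : Prop :=
  (∃ x v y : ℕ → Fin d → ℝ, IsGradRun p L κ ε R f x₀ x v y) ∧
  ∀ x v y : ℕ → Fin d → ℝ, IsGradRun p L κ ε R f x₀ x v y →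
    ∃ K : ℕ, (K : ℝ) ≤ N ∧ ∀ k, K ≤ k → lpNorm (conjExp p) (grad f (y k)) ≤ ε

/-- Iteration bound for `1 < p ≤ 2`, without the logarithmic factor. -/
def rateLow (p L κ ε R : ℝ) : ℝ :=
  (2 * L / ε) ^ (κ / ((κ - 1) * (3 * κ - 2))) *
    (κ ^ (2 * κ) / (κ - 1) ^ (2 * κ) * (R ^ κ / (p - 1) ^ κ)) ^ (1 / (3 * κ - 2))

/-- Iteration bound for `p > 2`, without the logarithmic factor. -/
def rateHigh (p L κ ε R : ℝ) : ℝ :=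
  (2 * L * R ^ (κ - 1) / ε) ^ (κ * (p - 1) / ((κ - 1) * (p * κ - p + κ))) *
    (κ / (κ - 1)) ^ (p / (p * κ - p + κ))

end GenAGD

end

/-!
The regularizer `ψ = ‖· - x₀‖_p ^ q / (q P)`, where `q = max p 2` and `P = min (p - 1) 1`
(`psiScale`), is `q`-uniformly convex with constant `2 ^ (2 - q)` (`psi_segment_le`). For `p > 2`
this is a coordinatewise inequality for `|·| ^ p`; for `p ≤ 2` it follows from a lower bound on the
second derivative of `(∑ (s_i² + e) ^ (p / 2)) ^ (2 / p)` along lines, as `e → 0`. Derivatives of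
`ψ` are never needed: optimality at a minimizer is expressed by comparison along segments.

*Accuracy.* By weak smoothness and Young's inequality, `f` lies below its linearization plus
`M_k / q * ‖·‖ ^ q + δ_k / 2`. The step rule is made so that the uniform convexity of the function
defining `v_k` absorbs the first of these terms; the errors `δ_k` add up to `A_k` times half the
target accuracy (`IsRun.objective_le_model`). Hence the regularized objective at `y_k` exceeds its
minimum by at most `m₀ ψ(w) / A_k` plus half the target accuracy, where `w` is the minimizer.
Accuracy in value bounds `∇f(y_k) - ∇f(w)` (`WeaklySmooth.lpNorm_grad_sub_le`), and `∇f(w)` is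
small because `-∇f(w)` is a subgradient of `λψ` at `w` and `w` is no farther from `x₀` than the
minimizer of `f` (`IsRun.lpNorm_grad_le`). So `‖∇f(y_k)‖ ≤ ε` as soon as `A_k` exceeds a certain
target `T`.

*Counting.* All constants are powers of the data: with `B = M_0 = m₀` one has
`M_k = B (A_k / a_k) ^ ((q - κ) / κ)`, so `A_k` grows geometrically, with a relative increment of
order `min 1 (ρ ^ (-θ))` for `ρ = B / λ` and `θ = κ / (q κ - q + κ)`
(`IsStepRule.partialSum_succ_ge`). This gives about `max 1 (ρ ^ θ) * log T` iterations. The bounds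
are uniform in `κ` because `ρ ^ θ` is smaller than the claimed rate by a factor of order `κ - 1`,
which compensates for `log ρ` being as large as `1 / (κ - 1)` times the logarithm in the claim,
and because `T` is bounded by a multiple of `ρ ^ (q / (q - 1))`, which settles the case `ρ ≤ 1`
(`iteration_count_le`).
-/

namespace GenAGD

/-! ### The `ℓ_p` norm and its dual -/

lemma lpNorm_nonneg {d : ℕ} (p : ℝ) (x : Fin d → ℝ) : 0 ≤ lpNorm p x :=
  Real.rpow_nonneg (sum_nonneg fun _ _ => Real.rpow_nonneg (abs_nonneg _) _) _

lemma lpNorm_rpow {d : ℕ} {p : ℝ} (hp : 0 < p) (x : Fin d → ℝ) :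
    lpNorm p x ^ p = ∑ i, |x i| ^ p := by
  unfold lpNorm
  rw [← Real.rpow_mul (sum_nonneg fun _ _ => Real.rpow_nonneg (abs_nonneg _) _),
    one_div_mul_cancel hp.ne', Real.rpow_one]

lemma lpNorm_smul {d : ℕ} {p : ℝ} (hp : 0 < p) (c : ℝ) (x : Fin d → ℝ) :
    lpNorm p (c • x) = |c| * lpNorm p x := by
  unfold lpNorm
  have : ∑ i, |(c • x) i| ^ p = |c| ^ p * ∑ i, |x i| ^ p := by
    rw [mul_sum]
    refine sum_congr rfl fun i _ => ?_
    rw [Pi.smul_apply, smul_eq_mul, abs_mul, Real.mul_rpow (abs_nonneg _) (abs_nonneg _)]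
  rw [this, Real.mul_rpow (Real.rpow_nonneg (abs_nonneg _) _)
    (sum_nonneg fun _ _ => Real.rpow_nonneg (abs_nonneg _) _), ← Real.rpow_mul (abs_nonneg _),
    mul_one_div_cancel hp.ne', Real.rpow_one]

lemma lpNorm_neg {d : ℕ} (p : ℝ) (x : Fin d → ℝ) : lpNorm p (-x) = lpNorm p x := by
  simp [lpNorm]

lemma lpNorm_sub_comm {d : ℕ} (p : ℝ) (x y : Fin d → ℝ) :
    lpNorm p (x - y) = lpNorm p (y - x) := by
  rw [← lpNorm_neg, neg_sub]

lemma lpNorm_add_le {d : ℕ} {p : ℝ} (hp : 1 ≤ p) (x y : Fin d → ℝ) :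
    lpNorm p (x + y) ≤ lpNorm p x + lpNorm p y :=
  Real.Lp_add_le univ x y hp

lemma holderConjugate_conjExp {p : ℝ} (hp : 1 < p) : p.HolderConjugate (conjExp p) :=
  Real.HolderConjugate.conjExponent hp

lemma dotProduct_le_lpNorm {d : ℕ} {p : ℝ} (hp : 1 < p) (g h : Fin d → ℝ) :
    g ⬝ᵥ h ≤ lpNorm (conjExp p) g * lpNorm p h :=
  Real.inner_le_Lp_mul_Lq univ g h (holderConjugate_conjExp hp).symm

lemma abs_apply_le_lpNorm {d : ℕ} {p : ℝ} (hp : 0 < p) (x : Fin d → ℝ) (i : Fin d) :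
    |x i| ≤ lpNorm p x := by
  refine (Real.rpow_le_rpow_iff (abs_nonneg _) (lpNorm_nonneg _ _) hp).1 ?_
  rw [lpNorm_rpow hp]
  exact single_le_sum (f := fun i => |x i| ^ p)
    (fun _ _ => Real.rpow_nonneg (abs_nonneg _) _) (mem_univ i)

lemma norm_le_lpNorm {d : ℕ} {p : ℝ} (hp : 0 < p) (x : Fin d → ℝ) : ‖x‖ ≤ lpNorm p x :=
  (pi_norm_le_iff_of_nonneg (lpNorm_nonneg _ _)).2 fun i => abs_apply_le_lpNorm hp x i

lemma lpNorm_pos {d : ℕ} {p : ℝ} (hp : 0 < p) {x : Fin d → ℝ} (hx : x ≠ 0) : 0 < lpNorm p x :=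
  (norm_pos_iff.2 hx).trans_le (norm_le_lpNorm hp x)

lemma continuous_lpNorm {d : ℕ} {p : ℝ} (hp : 0 < p) :
    Continuous (lpNorm p : (Fin d → ℝ) → ℝ) := by
  unfold lpNorm
  refine Continuous.rpow_const (continuous_finsetSum _ fun i _ => ?_)
    fun _ => Or.inr (by positivity)
  exact ((continuous_apply i).abs).rpow_const fun _ => Or.inr hp.le

/-- The `ℓ_{p_*}` norm is attained as a dual norm, at the vector `sign (g_i) |g_i| ^ (p_* - 1)`
after normalization. -/
lemma exists_dual_vector {d : ℕ} {p : ℝ} (hp : 1 < p) (g : Fin d → ℝ) :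
    ∃ h : Fin d → ℝ, lpNorm p h ≤ 1 ∧ g ⬝ᵥ h = lpNorm (conjExp p) g := by
  have hc := holderConjugate_conjExp hp
  set r := conjExp p with hr
  have hp0 : 0 < p := by linarith
  have hr1 : 1 < r := hc.symm.lt
  have hr0 : 0 < r := by linarith
  by_cases hg : g = 0
  · refine ⟨0, ?_, ?_⟩
    · simp [lpNorm, Real.zero_rpow hp0.ne', Real.zero_rpow (inv_pos.2 hp0).ne']
    · simp [hg, lpNorm, Real.zero_rpow hr0.ne', Real.zero_rpow (inv_pos.2 hr0).ne']
  have hG := lpNorm_pos hr0 hg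
  set G := lpNorm r g with hGdef
  set h : Fin d → ℝ := fun i => SignType.sign (g i) * |g i| ^ (r - 1) with hh
  have habs : ∀ i, |h i| ^ p = |g i| ^ r := by
    intro i
    have hrp : (r - 1) * p = r := by
      have := hc.symm.sub_one_mul_conj
      linarith [this]
    by_cases hgi : g i = 0
    · simp [hh, hgi, Real.zero_rpow hp0.ne', Real.zero_rpow hr0.ne']
    · have : |h i| = |g i| ^ (r - 1) := by
        simp only [hh, abs_mul, Real.abs_rpow_of_nonneg (abs_nonneg _), abs_abs]
        rcases lt_or_gt_of_ne hgi with h1 | h1 <;> simp [h1]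
      rw [this, ← Real.rpow_mul (abs_nonneg _), hrp]
  have hdot : g ⬝ᵥ h = G ^ r := by
    rw [hGdef, lpNorm_rpow hr0]
    refine sum_congr rfl fun i _ => ?_
    have : g i * h i = |g i| * |g i| ^ (r - 1) := by
      simp only [hh, ← mul_assoc, self_mul_sign]
    rw [this]
    by_cases hgi : g i = 0
    · simp [hgi, Real.zero_rpow hr0.ne']
    · rw [← Real.rpow_one_add' (abs_nonneg _) (by linarith)]; congr 1; ring
  have hnorm : lpNorm p h = G ^ (r - 1) := by
    have : lpNorm p h = (G ^ r) ^ (1 / p) := by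
      rw [hGdef, lpNorm_rpow hr0, lpNorm]
      simp only [habs]
    rw [this, ← Real.rpow_mul hG.le]
    congr 1
    have := hc.symm.sub_one_mul_conj
    field_simp; linarith
  refine ⟨(G ^ (r - 1))⁻¹ • h, ?_, ?_⟩
  · rw [lpNorm_smul hp0, hnorm, abs_of_pos (by positivity),
      inv_mul_cancel₀ (Real.rpow_pos_of_pos hG _).ne']
  · rw [dotProduct_smul, hdot, smul_eq_mul, Real.rpow_sub_one hG.ne']
    have := (Real.rpow_pos_of_pos hG r).ne'
    field_simp

/-- A bound on a linear functional relative to `‖·‖_p` is a bound on its `ℓ_{p_*}` norm. -/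
lemma lpNorm_conjExp_le_of_forall {d : ℕ} {p G : ℝ} (hp : 1 < p) (hG : 0 ≤ G) {g : Fin d → ℝ}
    (h : ∀ w : Fin d → ℝ, g ⬝ᵥ w ≤ G * lpNorm p w) : lpNorm (conjExp p) g ≤ G := by
  obtain ⟨w, hw, hgw⟩ := exists_dual_vector hp g
  rw [← hgw]
  exact (h w).trans (mul_le_of_le_one_right hG hw)

/-! ### Uniform convexity of the regularizer -/

/-- The duality map `s ↦ |s| ^ (p - 2) s` of the line is uniformly monotone for `p ≥ 2`. -/
lemma rpow_sub_one_le_sub_dualityMap {p : ℝ} (hp : 2 < p) {x y : ℝ} (hyx : y ≤ x) :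
    2 ^ (2 - p) * (x - y) ^ (p - 1) ≤ |x| ^ (p - 2) * x - |y| ^ (p - 2) * y := by
  have hD : ∀ s : ℝ, 0 ≤ s → |s| ^ (p - 2) * s = s ^ (p - 1) := by
    intro s hs
    rw [abs_of_nonneg hs, ← Real.rpow_add_one' hs (by linarith)]; congr 1; ring
  have hc : (2 : ℝ) ^ (2 - p) ≤ 1 := Real.rpow_le_one_of_one_le_of_nonpos (by norm_num) (by linarith)
  have hsame : ∀ x y : ℝ, 0 ≤ y → y ≤ x →
      2 ^ (2 - p) * (x - y) ^ (p - 1) ≤ |x| ^ (p - 2) * x - |y| ^ (p - 2) * y := by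
    intro x y hy hyx
    rw [hD x (hy.trans hyx), hD y hy]
    have h1 := Real.add_rpow_le_rpow_add (a := x - y) (b := y) (by linarith) hy
      (p := p - 1) (by linarith)
    rw [sub_add_cancel] at h1
    have h2 : 2 ^ (2 - p) * (x - y) ^ (p - 1) ≤ (x - y) ^ (p - 1) :=
      mul_le_of_le_one_left (Real.rpow_nonneg (by linarith) _) hc
    linarith
  rcases le_total 0 y with hy | hy
  · exact hsame x y hy hyx
  rcases le_total 0 x with hx | hx
  · have h1 : (x - y) ^ (p - 1) ≤ 2 ^ (p - 1 - 1) * (x ^ (p - 1) + (-y) ^ (p - 1)) := by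
      have := NNReal.rpow_add_le_mul_rpow_add_rpow ⟨x, hx⟩ ⟨-y, by linarith⟩
        (p := p - 1) (by linarith)
      rw [sub_eq_add_neg x y]
      exact_mod_cast this
    have h2 := hD (-y) (by linarith)
    rw [abs_neg, mul_neg] at h2
    rw [hD x hx, sub_eq_add_neg (x ^ _), h2]
    calc 2 ^ (2 - p) * (x - y) ^ (p - 1)
        ≤ 2 ^ (2 - p) * (2 ^ (p - 1 - 1) * (x ^ (p - 1) + (-y) ^ (p - 1))) := by gcongr
      _ = x ^ (p - 1) + (-y) ^ (p - 1) := by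
          rw [← mul_assoc, ← Real.rpow_add (by norm_num)]
          ring_nf; norm_num
  · have := hsame (-y) (-x) (by linarith) (by linarith)
    rw [abs_neg, abs_neg] at this
    calc _ = 2 ^ (2 - p) * (-y - -x) ^ (p - 1) := by congr 2; ring
      _ ≤ _ := this
      _ = _ := by ring

/-- Uniform convexity of `|·| ^ p` on the line, in first-order form. -/
lemma abs_rpow_add_le_abs_rpow {p : ℝ} (hp : 2 < p) (a b : ℝ) :
    |a| ^ p + p * (|a| ^ (p - 2) * a) * (b - a) + 2 ^ (2 - p) * |b - a| ^ p ≤ |b| ^ p := by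
  have key : ∀ a b : ℝ, a ≤ b →
      |a| ^ p + p * (|a| ^ (p - 2) * a) * (b - a) + 2 ^ (2 - p) * |b - a| ^ p ≤ |b| ^ p := by
    intro a b hab
    let F : ℝ → ℝ := fun s =>
      |s| ^ p - p * (|a| ^ (p - 2) * a) * (s - a) - 2 ^ (2 - p) * |s - a| ^ p
    have hF : ∀ s, HasDerivAt F (p * |s| ^ (p - 2) * s - p * (|a| ^ (p - 2) * a) * 1
        - 2 ^ (2 - p) * (p * |s - a| ^ (p - 2) * (s - a) * 1)) s := by
      intro s
      have h1 := hasDerivAt_abs_rpow s (p := p) (by linarith)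
      have h0 : HasDerivAt (fun s => s - a) 1 s := (hasDerivAt_id s).sub_const a
      have h2 := (hasDerivAt_abs_rpow (s - a) (p := p) (by linarith)).comp s h0
      exact (h1.sub (h0.const_mul _)).sub (h2.const_mul _)
    have hmono : MonotoneOn F (Set.Ici a) := by
      refine monotoneOn_of_hasDerivWithinAt_nonneg (convex_Ici a)
        (fun s _ => (hF s).continuousAt.continuousWithinAt)
        (fun s _ => (hF s).hasDerivWithinAt) fun s hs => ?_
      rw [interior_Ici] at hs
      have hs' : a < s := hs
      have h1 := rpow_sub_one_le_sub_dualityMap hp hs'.le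
      have h2 : |s - a| ^ (p - 2) * (s - a) = (s - a) ^ (p - 1) := by
        rw [abs_of_pos (by linarith), ← Real.rpow_add_one (by linarith)]; congr 1; ring
      have : 0 ≤ p * (|s| ^ (p - 2) * s - |a| ^ (p - 2) * a -
          2 ^ (2 - p) * (s - a) ^ (p - 1)) := mul_nonneg (by linarith) (by linarith)
      rw [← h2] at this
      linarith
    have := hmono (Set.self_mem_Ici) hab hab
    simp only [F, sub_self, mul_zero, abs_zero] at this
    rw [Real.zero_rpow (by linarith)] at this
    linarith
  rcases le_total a b with hab | hab
  · exact key a b hab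
  · have := key (-a) (-b) (by linarith)
    rw [abs_neg, abs_neg, ← neg_sub', abs_neg] at this
    linarith

lemma abs_rpow_segment_le {p : ℝ} (hp : 2 < p) (a b : ℝ) {t : ℝ} (ht0 : 0 ≤ t) (ht1 : t ≤ 1) :
    |a + t * (b - a)| ^ p ≤
      (1 - t) * |a| ^ p + t * |b| ^ p - 2 ^ (2 - p) * (t * (1 - t) ^ p) * |b - a| ^ p := by
  set w := a + t * (b - a) with hw
  have h1 := abs_rpow_add_le_abs_rpow hp w a
  have h2 := abs_rpow_add_le_abs_rpow hp w b
  have h3 : |b - w| ^ p = (1 - t) ^ p * |b - a| ^ p := by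
    rw [show b - w = (1 - t) * (b - a) by rw [hw]; ring, abs_mul,
      Real.mul_rpow (abs_nonneg _) (abs_nonneg _), abs_of_nonneg (by linarith : 0 ≤ 1 - t)]
  have h4 : 0 ≤ (2 : ℝ) ^ (2 - p) * |a - w| ^ p := by positivity
  rw [h3] at h2
  have h1' : |w| ^ p + p * (|w| ^ (p - 2) * w) * (a - w) ≤ |a| ^ p := by linarith
  have e1 := mul_le_mul_of_nonneg_left h1' (by linarith : 0 ≤ 1 - t)
  have e2 := mul_le_mul_of_nonneg_left h2 ht0
  have e3 : (1 - t) * (p * (|w| ^ (p - 2) * w) * (a - w)) +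
      t * (p * (|w| ^ (p - 2) * w) * (b - w)) = 0 := by
    rw [hw]; ring
  linarith

/-- `‖·‖_p ^ p` is `p`-uniformly convex with respect to `‖·‖_p` for `p > 2`. -/
lemma lpNorm_rpow_segment_le {d : ℕ} {p : ℝ} (hp : 2 < p) (x y : Fin d → ℝ) {t : ℝ}
    (ht0 : 0 ≤ t) (ht1 : t ≤ 1) :
    lpNorm p (x + t • (y - x)) ^ p ≤ (1 - t) * lpNorm p x ^ p + t * lpNorm p y ^ p -
      2 ^ (2 - p) * (t * (1 - t) ^ p) * lpNorm p (y - x) ^ p := by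
  have hp0 : 0 < p := by linarith
  simp only [lpNorm_rpow hp0, mul_sum, ← sum_add_distrib, ← sum_sub_distrib]
  exact sum_le_sum fun i _ => abs_rpow_segment_le hp (x i) (y i) ht0 ht1

/-- Hölder's inequality behind the strong convexity of `‖·‖_p ^ 2` for `p ≤ 2`. -/
lemma lpNorm_sq_le_weighted {d : ℕ} {p : ℝ} (hp1 : 1 < p) (hp2 : p ≤ 2) (h m : Fin d → ℝ)
    (hm : ∀ i, 0 < m i) :
    lpNorm p h ^ 2 ≤ (∑ i, m i ^ (p / 2)) ^ (2 / p - 1) * ∑ i, m i ^ (p / 2 - 1) * h i ^ 2 := by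
  have hp0 : 0 < p := by linarith
  have hN : 0 ≤ ∑ i, m i ^ (p / 2) := sum_nonneg fun i _ => (Real.rpow_pos_of_pos (hm i) _).le
  have hQ : 0 ≤ ∑ i, m i ^ (p / 2 - 1) * h i ^ 2 :=
    sum_nonneg fun i _ => mul_nonneg (Real.rpow_pos_of_pos (hm i) _).le (sq_nonneg _)
  have key := Real.inner_le_weight_mul_Lp_of_nonneg univ (p := 2 / p)
    ((one_le_div hp0).2 hp2) (fun i => m i ^ (p / 2)) (fun i => |h i| ^ p * m i ^ (-(p / 2)))
    (fun i => (Real.rpow_pos_of_pos (hm i) _).le)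
    (fun i => mul_nonneg (Real.rpow_nonneg (abs_nonneg _) _) (Real.rpow_pos_of_pos (hm i) _).le)
  have e1 : ∀ i, m i ^ (p / 2) * (|h i| ^ p * m i ^ (-(p / 2))) = |h i| ^ p := by
    intro i
    rw [mul_left_comm, ← Real.rpow_add (hm i)]; simp
  have e2 : ∀ i, m i ^ (p / 2) * (|h i| ^ p * m i ^ (-(p / 2))) ^ (2 / p) =
      m i ^ (p / 2 - 1) * h i ^ 2 := by
    intro i
    rw [Real.mul_rpow (by positivity) (Real.rpow_pos_of_pos (hm i) _).le,
      ← Real.rpow_mul (abs_nonneg _), ← Real.rpow_mul (hm i).le, mul_left_comm,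
      ← Real.rpow_add (hm i), mul_div_cancel₀ _ hp0.ne', mul_comm, Real.rpow_two, sq_abs]
    congr 2; field_simp; ring
  simp only [e1, e2, inv_div] at key
  have h2 : lpNorm p h ^ 2 = (∑ i, |h i| ^ p) ^ (2 / p) := by
    rw [← lpNorm_rpow hp0, ← Real.rpow_mul (lpNorm_nonneg _ _), mul_div_cancel₀ _ hp0.ne',
      Real.rpow_two]
  rw [h2]
  calc (∑ i, |h i| ^ p) ^ (2 / p) ≤ _ :=
        Real.rpow_le_rpow (sum_nonneg fun i _ => by positivity) key (by positivity)
    _ = _ := by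
        rw [Real.mul_rpow (by positivity) (by positivity), ← Real.rpow_mul hN, ← Real.rpow_mul hQ,
          div_mul_div_cancel₀ (by norm_num), div_self hp0.ne', Real.rpow_one]
        congr 2; field_simp

/-- Strong convexity along a line of the smooth approximation `(∑ (s_i² + e) ^ (p / 2)) ^ (2 / p)`
of `‖s‖_p ^ 2`. -/
lemma convexOn_smoothed_lpNorm_sq {d : ℕ} {p e : ℝ} (hp1 : 1 < p) (hp2 : p ≤ 2) (he : 0 < e)
    (hd : 0 < d) (x h : Fin d → ℝ) :
    ConvexOn ℝ Set.univ fun t : ℝ =>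
      (∑ i, ((x i + t * h i) ^ 2 + e) ^ (p / 2)) ^ (2 / p) - (p - 1) * lpNorm p h ^ 2 * t ^ 2 := by
  have : Nonempty (Fin d) := ⟨⟨0, hd⟩⟩
  have hp0 : 0 < p := by linarith
  set s : Fin d → ℝ → ℝ := fun i t => x i + t * h i with hs
  set m : Fin d → ℝ → ℝ := fun i t => s i t ^ 2 + e with hm
  have hm0 : ∀ i t, 0 < m i t := fun i t => by positivity
  have hsd : ∀ i t, HasDerivAt (s i) (h i) t := by
    intro i t
    exact (((hasDerivAt_id t).mul_const (h i)).const_add (x i)).congr_deriv (one_mul _)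
  have hmd : ∀ i t, HasDerivAt (m i) (2 * s i t * h i) t := by
    intro i t
    exact (((hsd i t).pow 2).add_const e).congr_deriv (by simp)
  have hmr : ∀ r i t, HasDerivAt (fun t => m i t ^ r) (2 * s i t * h i * r * m i t ^ (r - 1)) t :=
    fun r i t => (hmd i t).rpow_const (Or.inl (hm0 i t).ne')
  set N : ℝ → ℝ := fun t => ∑ i, m i t ^ (p / 2) with hN
  set N' : ℝ → ℝ := fun t => ∑ i, p * (m i t ^ (p / 2 - 1) * (s i t * h i)) with hN'
  set N'' : ℝ → ℝ := fun t => ∑ i, p * (2 * s i t * h i * (p / 2 - 1) * m i t ^ (p / 2 - 1 - 1) *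
    (s i t * h i) + m i t ^ (p / 2 - 1) * (h i * h i)) with hN''
  have hN0 : ∀ t, 0 < N t := fun t =>
    sum_pos (fun i _ => Real.rpow_pos_of_pos (hm0 i t) _) univ_nonempty
  have hNd : ∀ t, HasDerivAt N (N' t) t := by
    intro t
    have := HasDerivAt.fun_sum (u := univ) fun i _ => hmr (p / 2) i t
    refine this.congr_deriv (sum_congr rfl fun i _ => ?_)
    ring
  have hNd' : ∀ t, HasDerivAt N' (N'' t) t := by
    intro t
    exact HasDerivAt.fun_sum (u := univ) fun i _ =>
      ((hmr (p / 2 - 1) i t).mul ((hsd i t).mul_const (h i))).const_mul p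
  -- The second derivative of each summand loses at most the factor `p - 1`.
  have hN''ge : ∀ t, p * (p - 1) * ∑ i, m i t ^ (p / 2 - 1) * h i ^ 2 ≤ N'' t := by
    intro t
    rw [mul_sum]
    refine sum_le_sum fun i _ => ?_
    have e1 : m i t ^ (p / 2 - 1) = m i t ^ (p / 2 - 1 - 1) * m i t := by
      rw [← Real.rpow_add_one (hm0 i t).ne']; congr 1; ring
    have e2 : 0 ≤ m i t ^ (p / 2 - 1 - 1) := (Real.rpow_pos_of_pos (hm0 i t) _).le
    have e3 : m i t = s i t ^ 2 + e := rfl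
    rw [e1]
    have : 0 ≤ p * (m i t ^ (p / 2 - 1 - 1) * h i ^ 2) * ((2 - p) * e) :=
      mul_nonneg (mul_nonneg hp0.le (mul_nonneg e2 (sq_nonneg _)))
        (mul_nonneg (by linarith) he.le)
    rw [← sub_nonneg]
    calc (0 : ℝ) ≤ _ := this
      _ = _ := by
        generalize m i t ^ (p / 2 - 1 - 1) = c
        rw [e3]; ring
  have hF1 : ∀ t, HasDerivAt
      (fun t => N t ^ (2 / p) - (p - 1) * lpNorm p h ^ 2 * t ^ 2)
      (2 / p * (N' t * N t ^ (2 / p - 1)) - (p - 1) * lpNorm p h ^ 2 * (2 * t)) t := by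
    intro t
    have h1 := (hNd t).rpow_const (p := 2 / p) (Or.inl (hN0 t).ne')
    have h2 := ((hasDerivAt_id t).pow 2).const_mul ((p - 1) * lpNorm p h ^ 2)
    refine (h1.sub h2).congr_deriv ?_
    simp; ring
  have hF2 : ∀ t, HasDerivAt
      (fun t => 2 / p * (N' t * N t ^ (2 / p - 1)) - (p - 1) * lpNorm p h ^ 2 * (2 * t))
      (2 / p * (N'' t * N t ^ (2 / p - 1) + N' t * (N' t * (2 / p - 1) * N t ^ (2 / p - 1 - 1))) -
        (p - 1) * lpNorm p h ^ 2 * 2) t := by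
    intro t
    have h1 := ((hNd' t).mul ((hNd t).rpow_const (p := 2 / p - 1) (Or.inl (hN0 t).ne'))).const_mul
      (2 / p)
    have h2 := ((hasDerivAt_id t).const_mul 2).const_mul ((p - 1) * lpNorm p h ^ 2)
    exact (h1.sub h2).congr_deriv (by simp)
  refine Monotone.convexOn_univ_of_deriv (fun t => (hF1 t).differentiableAt) ?_
  have : deriv (fun t => N t ^ (2 / p) - (p - 1) * lpNorm p h ^ 2 * t ^ 2) = fun t =>
      2 / p * (N' t * N t ^ (2 / p - 1)) - (p - 1) * lpNorm p h ^ 2 * (2 * t) :=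
    funext fun t => (hF1 t).deriv
  rw [this]
  refine monotone_of_hasDerivAt_nonneg hF2 fun t => ?_
  have hH := lpNorm_sq_le_weighted hp1 hp2 h (fun i => m i t) fun i => hm0 i t
  set Q := ∑ i, m i t ^ (p / 2 - 1) * h i ^ 2 with hQ
  have a1 : 0 ≤ 2 / p * (N' t * (N' t * (2 / p - 1) * N t ^ (2 / p - 1 - 1))) := by
    have : 0 ≤ 2 / p - 1 := by rw [sub_nonneg]; exact (one_le_div hp0).2 hp2
    have h3 : 0 ≤ N t ^ (2 / p - 1 - 1) := (Real.rpow_pos_of_pos (hN0 t) _).le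
    have : 0 ≤ 2 / p * ((2 / p - 1) * N t ^ (2 / p - 1 - 1) * (N' t * N' t)) :=
      mul_nonneg (by positivity) (mul_nonneg (mul_nonneg this h3) (mul_self_nonneg _))
    linarith
  have a2 : 2 / p * ((p * (p - 1) * Q) * N t ^ (2 / p - 1)) ≤
      2 / p * (N'' t * N t ^ (2 / p - 1)) := by gcongr; exact hN''ge t
  have a3 : 2 / p * ((p * (p - 1) * Q) * N t ^ (2 / p - 1)) =
      2 * (p - 1) * (N t ^ (2 / p - 1) * Q) := by field_simp
  have a4 : 2 * (p - 1) * lpNorm p h ^ 2 ≤ 2 * (p - 1) * (N t ^ (2 / p - 1) * Q) :=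
    mul_le_mul_of_nonneg_left hH (by linarith)
  show (0 : ℝ) ≤ _
  linarith

/-- `‖·‖_p ^ 2` is strongly convex with respect to `‖·‖_p` for `1 < p ≤ 2`. -/
lemma lpNorm_sq_segment_le {d : ℕ} {p : ℝ} (hp1 : 1 < p) (hp2 : p ≤ 2) (x y : Fin d → ℝ) {t : ℝ}
    (ht0 : 0 ≤ t) (ht1 : t ≤ 1) :
    lpNorm p (x + t • (y - x)) ^ 2 ≤ (1 - t) * lpNorm p x ^ 2 + t * lpNorm p y ^ 2 -
      (p - 1) * (t * (1 - t)) * lpNorm p (y - x) ^ 2 := by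
  have hp0 : 0 < p := by linarith
  rcases Nat.eq_zero_or_pos d with rfl | hd
  · simp [lpNorm, Real.zero_rpow (inv_pos.2 hp0).ne']
  set S : ℝ → (Fin d → ℝ) → ℝ := fun e z => (∑ i, (z i ^ 2 + e) ^ (p / 2)) ^ (2 / p) with hS
  have hS0 : ∀ z, S 0 z = lpNorm p z ^ 2 := by
    intro z
    have : ∀ i, (z i ^ 2 + 0) ^ (p / 2) = |z i| ^ p := by
      intro i
      rw [add_zero, ← sq_abs, ← Real.rpow_two, ← Real.rpow_mul (abs_nonneg _)]
      congr 1; ring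
    simp only [hS, this]
    rw [← lpNorm_rpow hp0, ← Real.rpow_mul (lpNorm_nonneg _ _), mul_div_cancel₀ _ hp0.ne',
      Real.rpow_two]
  have hcont : ∀ z, Filter.Tendsto (fun e => S e z) (nhdsWithin 0 (Set.Ioi 0)) (nhds (S 0 z)) := by
    intro z
    have : Continuous fun e => S e z := by
      refine Continuous.rpow_const (continuous_finsetSum _ fun i _ => ?_)
        fun _ => Or.inr (by positivity)
      exact (continuous_const.add continuous_id).rpow_const fun _ => Or.inr (by positivity)
    exact (this.tendsto 0).mono_left nhdsWithin_le_nhds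
  rw [← hS0, ← hS0 x, ← hS0 y]
  refine le_of_tendsto_of_tendsto (hcont _)
    ((((hcont x).const_mul (1 - t)).add ((hcont y).const_mul t)).sub_const _) ?_
  filter_upwards [self_mem_nhdsWithin] with e he
  have hconv := (convexOn_smoothed_lpNorm_sq hp1 hp2 he hd x (y - x)).2 (Set.mem_univ 0)
    (Set.mem_univ 1) (by linarith : 0 ≤ 1 - t) ht0 (by ring)
  simp only [smul_eq_mul, mul_zero, mul_one, zero_add, zero_mul, add_zero, one_mul, one_pow,
    Pi.sub_apply, add_sub_cancel, ne_eq, OfNat.ofNat_ne_zero, not_false_eq_true, zero_pow,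
    sub_zero] at hconv
  simp only [hS, Pi.add_apply, Pi.smul_apply, Pi.sub_apply, smul_eq_mul]
  linarith

/-- The factor `min (p - 1) 1` by which the regularizer is scaled, in the form common to both
ranges of `p`. -/
def psiScale (p : ℝ) : ℝ := min (p - 1) 1

lemma psiScale_pos {p : ℝ} (hp : 1 < p) : 0 < psiScale p := lt_min (by linarith) one_pos

lemma psiScale_le_one (p : ℝ) : psiScale p ≤ 1 := min_le_right _ _

lemma psi_eq {d : ℕ} (p : ℝ) (x₀ x : Fin d → ℝ) :
    psi p x₀ x = 1 / (max p 2 * psiScale p) * lpNorm p (x - x₀) ^ max p 2 := by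
  unfold psi psiScale
  split_ifs with h
  · rw [max_eq_right h, min_eq_left (by linarith)]
  · rw [max_eq_left (by linarith), min_eq_right (by linarith), mul_one]

lemma regParam_eq (p ε R : ℝ) :
    regParam p ε R = ε * psiScale p / (2 * R ^ (max p 2 - 1)) := by
  unfold regParam psiScale
  split_ifs with h
  · rw [max_eq_right h, min_eq_left (by linarith)]; norm_num
  · rw [max_eq_left (by linarith), min_eq_right (by linarith), mul_one]

/-- Uniform convexity of the regularizer. The factor `(1 - t) ^ q` is `1` to first order, which is
all that a comparison with a minimizer needs. -/
lemma psi_segment_le {d : ℕ} {p : ℝ} (hp : 1 < p) (x₀ x y : Fin d → ℝ) {t : ℝ}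
    (ht0 : 0 ≤ t) (ht1 : t ≤ 1) :
    psi p x₀ (x + t • (y - x)) ≤ (1 - t) * psi p x₀ x + t * psi p x₀ y -
      2 ^ (2 - max p 2) / max p 2 * (t * (1 - t) ^ max p 2) * lpNorm p (y - x) ^ max p 2 := by
  have e : x + t • (y - x) - x₀ = (x - x₀) + t • ((y - x₀) - (x - x₀)) := by
    rw [sub_sub_sub_cancel_right]; abel
  have e' : y - x = (y - x₀) - (x - x₀) := by abel
  unfold psi
  split_ifs with h
  · rw [max_eq_right h, e, e']
    have key := lpNorm_sq_segment_le hp h (x - x₀) (y - x₀) ht0 ht1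
    simp only [Real.rpow_two, sub_self, Real.rpow_zero]
    set Z := lpNorm p (y - x₀ - (x - x₀))
    have hP : 0 < p - 1 := by linarith
    have h1 : t * (1 - t) ^ 2 ≤ t * (1 - t) := by nlinarith [mul_nonneg ht0 (sub_nonneg.2 ht1)]
    have h2 : t * (1 - t) ^ 2 * Z ^ 2 ≤ t * (1 - t) * Z ^ 2 :=
      mul_le_mul_of_nonneg_right h1 (sq_nonneg _)
    have := mul_le_mul_of_nonneg_left key (by positivity : 0 ≤ 1 / (2 * (p - 1)))
    have e3 : 1 / (2 * (p - 1)) * ((p - 1) * (t * (1 - t)) * Z ^ 2) =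
      1 / 2 * (t * (1 - t) * Z ^ 2) := by field_simp
    linarith
  · rw [max_eq_left (by linarith), e, e']
    have key := lpNorm_rpow_segment_le (not_le.1 h) (x - x₀) (y - x₀) ht0 ht1
    have hp0 : 0 < p := by linarith
    have := mul_le_mul_of_nonneg_left key (by positivity : 0 ≤ 1 / p)
    have e3 : 1 / p * (2 ^ (2 - p) * (t * (1 - t) ^ p) * lpNorm p (y - x₀ - (x - x₀)) ^ p) =
      2 ^ (2 - p) / p * (t * (1 - t) ^ p) * lpNorm p (y - x₀ - (x - x₀)) ^ p := by ring
    linarith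

/-! ### Weakly smooth convex functions -/

lemma fderiv_apply_eq_grad_dotProduct {d : ℕ} (f : (Fin d → ℝ) → ℝ) (x h : Fin d → ℝ) :
    fderiv ℝ f x h = grad f x ⬝ᵥ h := by
  conv_lhs => rw [← Finset.univ_sum_single h]
  rw [map_sum]
  refine sum_congr rfl fun i _ => ?_
  have : (Pi.single i (h i) : Fin d → ℝ) = h i • Pi.single i 1 := by
    rw [← Pi.single_smul]; simp
  rw [this, map_smul, smul_eq_mul, mul_comm]
  rfl

lemma hasDerivAt_line {d : ℕ} {f : (Fin d → ℝ) → ℝ} (hf : Differentiable ℝ f)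
    (x h : Fin d → ℝ) (t : ℝ) :
    HasDerivAt (fun t : ℝ => f (x + t • h)) (grad f (x + t • h) ⬝ᵥ h) t := by
  have h1 : HasDerivAt (fun t : ℝ => x + t • h) h t := by
    simpa using ((hasDerivAt_id t).smul_const h).const_add x
  rw [← fderiv_apply_eq_grad_dotProduct]
  exact (hf (x + t • h)).hasFDerivAt.comp_hasDerivAt t h1

lemma add_grad_dotProduct_le {d : ℕ} {f : (Fin d → ℝ) → ℝ} (hf : Differentiable ℝ f)
    (hc : ConvexOn ℝ Set.univ f) (x y : Fin d → ℝ) :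
    f x + grad f x ⬝ᵥ (y - x) ≤ f y := by
  have hd := hasDerivAt_line hf x (y - x) 0
  rw [zero_smul, add_zero] at hd
  have hslope := hd.tendsto_slope_zero_right
  refine le_of_sub_nonneg ?_
  have : grad f x ⬝ᵥ (y - x) ≤ f y - f x := by
    refine le_of_tendsto hslope ?_
    filter_upwards [Ioo_mem_nhdsGT (one_pos : (0 : ℝ) < 1)] with t ht
    have := hc.2 (Set.mem_univ x) (Set.mem_univ y) (by linarith [ht.2] : 0 ≤ 1 - t) ht.1.le (by ring)
    have e : (1 - t) • x + t • y = x + t • (y - x) := by module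
    rw [e] at this
    simp only [zero_add, zero_smul, add_zero, smul_eq_mul] at this ⊢
    rw [inv_mul_le_iff₀ ht.1]
    linarith
  linarith

/-- The upper bound on a weakly smooth function by its linearization. -/
lemma WeaklySmooth.le_linearization_add {d : ℕ} {p L κ : ℝ} {f : (Fin d → ℝ) → ℝ} (hp : 1 < p)
    (hκ : 1 < κ) (hf : WeaklySmooth p L κ f) (x y : Fin d → ℝ) :
    f y ≤ f x + grad f x ⬝ᵥ (y - x) + L / κ * lpNorm p (y - x) ^ κ := by
  have hp0 : 0 < p := by linarith
  have hκ0 : 0 < κ := by linarith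
  set h := y - x with hh
  set Z := lpNorm p h with hZ
  have hZ0 : 0 ≤ Z := lpNorm_nonneg _ _
  let F : ℝ → ℝ := fun t => f (x + t • h) - t * (grad f x ⬝ᵥ h) - L / κ * Z ^ κ * t ^ κ
  have hF : ∀ t, 0 < t → HasDerivAt F
      (grad f (x + t • h) ⬝ᵥ h - 1 * (grad f x ⬝ᵥ h) - L / κ * Z ^ κ * (κ * t ^ (κ - 1))) t := by
    intro t ht
    exact ((hasDerivAt_line hf.1 x h t).sub ((hasDerivAt_id t).mul_const _)).sub
      ((Real.hasDerivAt_rpow_const (Or.inl ht.ne')).const_mul _)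
  have hFc : Continuous F := by
    refine ((hf.1.continuous.comp (by fun_prop)).sub (by fun_prop)).sub
      (continuous_const.mul ?_)
    exact continuous_id.rpow_const fun _ => Or.inr hκ0.le
  have hanti : AntitoneOn F (Set.Ici 0) := by
    refine antitoneOn_of_hasDerivWithinAt_nonpos (convex_Ici 0) hFc.continuousOn
      (fun t ht => (hF t (by simpa using ht)).hasDerivWithinAt) fun t ht => ?_
    have ht0 : 0 < t := by simpa using ht
    have h1 : (grad f (x + t • h) - grad f x) ⬝ᵥ h ≤ L * (t * Z) ^ (κ - 1) * Z := by
      refine (dotProduct_le_lpNorm hp _ _).trans (mul_le_mul_of_nonneg_right ?_ hZ0)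
      refine (hf.2 _ _).trans_eq ?_
      rw [add_sub_cancel_left, lpNorm_smul hp0, abs_of_pos ht0]
    have h2 : (t * Z) ^ (κ - 1) * Z = t ^ (κ - 1) * Z ^ κ := by
      rw [Real.mul_rpow ht0.le hZ0, mul_assoc, ← Real.rpow_add_one' hZ0 (by linarith)]
      congr 2; ring
    rw [sub_dotProduct, mul_assoc, h2] at h1
    have h3 : L / κ * Z ^ κ * (κ * t ^ (κ - 1)) = L * (t ^ (κ - 1) * Z ^ κ) := by field_simp
    linarith
  have := hanti (Set.self_mem_Ici) (zero_le_one : (0:ℝ) ≤ 1) zero_le_one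
  simp only [F, zero_smul, add_zero, zero_mul, one_smul, one_mul, Real.one_rpow, mul_one,
    Real.zero_rpow hκ0.ne', mul_zero, sub_zero] at this
  have hxy : x + h = y := by rw [hh]; abel
  rw [hxy] at this
  linarith

lemma smoothConst_pos {q L κ δ : ℝ} (hL : 0 < L) (hκ : 0 < κ) (hq : κ ≤ q) (hδ : 0 < δ) :
    0 < smoothConst q L κ δ := by
  have hq0 : 0 < q := by linarith
  unfold smoothConst
  refine mul_pos ?_ (Real.rpow_pos_of_pos hL _)
  rcases hq.eq_or_lt with rfl | h
  · simp
  · have : 0 < q - κ := by linarith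
    positivity

/-- Young's inequality: the growth `t ^ κ` is dominated by `t ^ q` up to the error `δ / 2`. -/
lemma rpow_le_smoothConst_mul_rpow_add {q L κ δ t : ℝ} (hL : 0 < L) (hκ : 0 < κ) (hq : κ ≤ q)
    (hδ : 0 < δ) (ht : 0 ≤ t) :
    L / κ * t ^ κ ≤ smoothConst q L κ δ / q * t ^ q + δ / 2 := by
  have hq0 : 0 < q := by linarith
  rcases hq.eq_or_lt with rfl | h
  · simp only [smoothConst, sub_self, zero_div, Real.rpow_zero, div_self hκ.ne', Real.rpow_one,
      one_mul]
    linarith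
  have hqκ : 0 < q - κ := by linarith
  set D := 2 * (q - κ) / (q * κ * δ) with hD
  have hD0 : 0 < D := by positivity
  have hconj : (q / κ).HolderConjugate (q / (q - κ)) := by
    rw [Real.holderConjugate_iff]
    refine ⟨(one_lt_div hκ).2 h, ?_⟩
    field_simp; ring
  have hy := Real.young_inequality_of_nonneg
    (a := D ^ ((q - κ) / q) * L * t ^ κ * κ ^ (-(κ / q)))
    (b := κ ^ (κ / q - 1) * D ^ (-((q - κ) / q))) (by positivity) (by positivity) hconj
  have e1 : D ^ ((q - κ) / q) * L * t ^ κ * κ ^ (-(κ / q)) *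
      (κ ^ (κ / q - 1) * D ^ (-((q - κ) / q))) = L / κ * t ^ κ := by
    have a1 : D ^ ((q - κ) / q) * D ^ (-((q - κ) / q)) = 1 := by
      rw [← Real.rpow_add hD0]; simp
    have a2 : κ ^ (-(κ / q)) * κ ^ (κ / q - 1) = κ⁻¹ := by
      rw [← Real.rpow_add hκ, ← Real.rpow_neg_one]; congr 1; ring
    calc _ = (D ^ ((q - κ) / q) * D ^ (-((q - κ) / q))) *
          (κ ^ (-(κ / q)) * κ ^ (κ / q - 1)) * L * t ^ κ := by ring
      _ = _ := by rw [a1, a2]; ring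
  have e2 : (D ^ ((q - κ) / q) * L * t ^ κ * κ ^ (-(κ / q))) ^ (q / κ) / (q / κ) =
      smoothConst q L κ δ / q * t ^ q := by
    rw [Real.mul_rpow (by positivity) (by positivity), Real.mul_rpow (by positivity) (by positivity),
      Real.mul_rpow (by positivity) (by positivity), ← Real.rpow_mul hD0.le, ← Real.rpow_mul ht,
      ← Real.rpow_mul hκ.le]
    have b1 : (q - κ) / q * (q / κ) = (q - κ) / κ := by field_simp
    have b2 : κ * (q / κ) = q := by field_simp
    have b3 : -(κ / q) * (q / κ) = -1 := by field_simp
    rw [b1, b2, b3, Real.rpow_neg_one, smoothConst, ← hD]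
    field_simp
  have e3 : (κ ^ (κ / q - 1) * D ^ (-((q - κ) / q))) ^ (q / (q - κ)) / (q / (q - κ)) = δ / 2 := by
    rw [Real.mul_rpow (by positivity) (by positivity), ← Real.rpow_mul hD0.le,
      ← Real.rpow_mul hκ.le]
    have b1 : (κ / q - 1) * (q / (q - κ)) = -1 := by field_simp; ring
    have b2 : -((q - κ) / q) * (q / (q - κ)) = -1 := by field_simp
    rw [b1, b2, Real.rpow_neg_one, Real.rpow_neg_one, hD]
    field_simp
  rwa [e1, e2, e3] at hy

lemma valueAcc_pos {L κ ε : ℝ} (hL : 0 < L) (hκ : 1 < κ) (hε : 0 < ε) : 0 < valueAcc L κ ε := by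
  have : 0 < κ - 1 := by linarith
  unfold valueAcc
  positivity

/-- Accuracy in the Bregman divergence controls accuracy in the gradient: a step from `y` along the
dual vector of `∇f(y) - ∇f(x)` would otherwise go below the minimum of the convex function
`u ↦ f u - ⟨∇f(x), u⟩`, which is attained at `x`. -/
lemma WeaklySmooth.lpNorm_grad_sub_le {d : ℕ} {p L κ ε : ℝ} {f : (Fin d → ℝ) → ℝ} (hp : 1 < p)
    (hL : 0 < L) (hκ : 1 < κ) (hε : 0 < ε) (hc : ConvexOn ℝ Set.univ f)
    (hf : WeaklySmooth p L κ f) {x y : Fin d → ℝ}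
    (hgap : f y - f x - grad f x ⬝ᵥ (y - x) ≤ valueAcc L κ ε) :
    lpNorm (conjExp p) (grad f y - grad f x) ≤ ε / 2 := by
  obtain ⟨h, hh1, hh⟩ := exists_dual_vector hp (grad f y - grad f x)
  set G := lpNorm (conjExp p) (grad f y - grad f x) with hG
  have hκ0 : 0 < κ := by linarith
  have hw : 0 < κ - 1 := by linarith
  set E := ε / 2 with hE
  have hE0 : 0 < E := by positivity
  set t := (E / L) ^ (1 / (κ - 1)) with ht
  have ht0 : 0 < t := by positivity
  have htp : t ^ κ = t * (E / L) := by
    rw [show κ = 1 + (κ - 1) by ring, Real.rpow_add ht0, Real.rpow_one, ht,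
      ← Real.rpow_mul (by positivity), one_div_mul_cancel (by linarith), Real.rpow_one]
  have hacc : valueAcc L κ ε = t * E * ((κ - 1) / κ) := by
    have e1 : E ^ (κ / (κ - 1)) = E * E ^ (1 / (κ - 1)) := by
      rw [← Real.rpow_one_add' hE0.le (by positivity)]; congr 1; field_simp; ring
    rw [valueAcc, e1, ht, Real.div_rpow hE0.le hL.le]
    field_simp
  have h1 := hf.le_linearization_add hp hκ y (y + (-t) • h)
  have h2 := add_grad_dotProduct_le hf.1 hc x (y + (-t) • h)
  have e1 : lpNorm p (y + (-t) • h - y) ^ κ ≤ t ^ κ := by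
    refine Real.rpow_le_rpow (lpNorm_nonneg _ _) ?_ hκ0.le
    rw [add_sub_cancel_left, lpNorm_smul (by linarith), abs_neg, abs_of_pos ht0]
    exact mul_le_of_le_one_right ht0.le hh1
  have e2 : L / κ * lpNorm p (y + (-t) • h - y) ^ κ ≤ L / κ * (t * (E / L)) := by
    rw [← htp]; gcongr
  have e3 : L / κ * (t * (E / L)) = t * E / κ := by field_simp
  have e4 : grad f x ⬝ᵥ (y + (-t) • h - x) = grad f x ⬝ᵥ (y - x) - t * (grad f x ⬝ᵥ h) := by
    rw [add_sub_right_comm, dotProduct_add, dotProduct_smul, smul_eq_mul]; ring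
  have e5 : grad f y ⬝ᵥ (y + (-t) • h - y) = - t * (grad f y ⬝ᵥ h) := by
    rw [add_sub_cancel_left, dotProduct_smul, smul_eq_mul]
  rw [sub_dotProduct] at hh
  rw [e4] at h2
  rw [e5] at h1
  have h3 : t * G ≤ valueAcc L κ ε + t * E / κ := by
    rw [← hh, mul_sub]; linarith
  have h4 : valueAcc L κ ε + t * E / κ = t * E := by rw [hacc]; field_simp; ring
  rw [h4] at h3
  exact le_of_mul_le_mul_left h3 ht0

/-! ### Minimizers of regularized functions and existence of runs -/

lemma two_le_max (p : ℝ) : (2 : ℝ) ≤ max p 2 := le_max_right _ _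

lemma continuous_psi {d : ℕ} {p : ℝ} (hp : 1 < p) (x₀ : Fin d → ℝ) : Continuous (psi p x₀) := by
  have : psi p x₀ = fun x => 1 / (max p 2 * psiScale p) * lpNorm p (x - x₀) ^ max p 2 :=
    funext fun x => psi_eq p x₀ x
  rw [this]
  refine continuous_const.mul (((continuous_lpNorm (by linarith)).comp
    (continuous_id.sub continuous_const)).rpow_const fun _ => Or.inr ?_)
  linarith [two_le_max p]

lemma rpow_div_le_psi {d : ℕ} {p : ℝ} (hp : 1 < p) (x₀ x : Fin d → ℝ) :
    1 / max p 2 * lpNorm p (x - x₀) ^ max p 2 ≤ psi p x₀ x := by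
  have hq := two_le_max p
  rw [psi_eq]
  refine mul_le_mul_of_nonneg_right ?_ (Real.rpow_nonneg (lpNorm_nonneg _ _) _)
  refine one_div_le_one_div_of_le (mul_pos (by linarith) (psiScale_pos hp)) ?_
  exact mul_le_of_le_one_right (by linarith) (psiScale_le_one p)

/-- A continuous function that decreases at most linearly attains its minimum once a positive
multiple of the regularizer is added. -/
lemma exists_isMinOn_add_psi {d : ℕ} {p c b e : ℝ} (hp : 1 < p) (hc : 0 < c) (x₀ : Fin d → ℝ)
    {G : (Fin d → ℝ) → ℝ} (hG : Continuous G) (hb : 0 ≤ b)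
    (hlow : ∀ u, e - b * lpNorm p (u - x₀) ≤ G u) :
    ∃ v, IsMinOn (fun u => G u + c * psi p x₀ u) Set.univ v := by
  have hq := two_le_max p
  set q := max p 2 with hqdef
  have hcont : Continuous fun u => G u + c * psi p x₀ u :=
    hG.add (continuous_const.mul (continuous_psi hp x₀))
  obtain ⟨v, hv⟩ := hcont.exists_forall_le' x₀ (by
    set T := 1 + q * (b + 1) / c + |G x₀ + c * psi p x₀ x₀ - e| with hT
    have hq0 : 0 < q := by linarith
    have htend := tendsto_norm_cocompact_atTop (E := Fin d → ℝ)
    filter_upwards [htend.eventually_ge_atTop (T + ‖x₀‖)] with u hu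
    set N := lpNorm p (u - x₀) with hN
    have hNT : T ≤ N := by
      have h1 := norm_le_lpNorm (p := p) (by linarith) (u - x₀)
      have h2 := norm_sub_norm_le u x₀
      linarith
    have hfrac : 0 ≤ q * (b + 1) / c := by positivity
    have habs := abs_nonneg (G x₀ + c * psi p x₀ x₀ - e)
    have hN1 : 1 ≤ N := by linarith
    have hpsi := rpow_div_le_psi hp x₀ u
    rw [← hqdef, ← hN] at hpsi
    have hpow : N ^ 2 ≤ N ^ q := by
      rw [← Real.rpow_two]; exact Real.rpow_le_rpow_of_exponent_le hN1 hq
    have h1 : c * (1 / q * N ^ 2) ≤ c * psi p x₀ u :=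
      mul_le_mul_of_nonneg_left ((mul_le_mul_of_nonneg_left hpow (by positivity)).trans hpsi) hc.le
    have h2 : b + 1 ≤ c / q * N := by
      have : q * (b + 1) / c ≤ N := by linarith
      rw [div_le_iff₀ hc] at this
      rw [div_mul_eq_mul_div, le_div_iff₀ hq0]; linarith
    have h3 : (b + 1) * N ≤ c * (1 / q * N ^ 2) := by
      calc (b + 1) * N ≤ c / q * N * N := by gcongr
        _ = _ := by ring
    have h4 := hlow u
    have h5 := le_abs_self (G x₀ + c * psi p x₀ x₀ - e)
    linarith)
  exact ⟨v, fun u _ => hv u⟩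

/-- Growth away from a minimizer, inherited from the uniform convexity of the regularizer. -/
lemma isMinOn_add_psi_growth {d : ℕ} {p c : ℝ} (hp : 1 < p) (hc : 0 ≤ c) {x₀ v : Fin d → ℝ}
    {G : (Fin d → ℝ) → ℝ} (hG : ConvexOn ℝ Set.univ G)
    (hmin : IsMinOn (fun u => G u + c * psi p x₀ u) Set.univ v) (u : Fin d → ℝ) :
    G v + c * psi p x₀ v + c * (2 ^ (2 - max p 2) / max p 2 * lpNorm p (u - v) ^ max p 2) ≤
      G u + c * psi p x₀ u := by
  have hq := two_le_max p
  set q := max p 2 with hqdef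
  set Z := 2 ^ (2 - q) / q with hZ
  set N := lpNorm p (u - v) ^ q
  have hlim : Filter.Tendsto (fun t : ℝ => G v + c * psi p x₀ v + c * (Z * (1 - t) ^ q * N))
      (nhdsWithin 0 (Set.Ioi 0)) (nhds (G v + c * psi p x₀ v + c * (Z * (1 - 0) ^ q * N))) := by
    have : Continuous fun t : ℝ => G v + c * psi p x₀ v + c * (Z * (1 - t) ^ q * N) := by
      have : Continuous fun t : ℝ => (1 - t) ^ q :=
        (continuous_const.sub continuous_id).rpow_const fun _ => Or.inr (by linarith)
      fun_prop
    exact (this.tendsto 0).mono_left nhdsWithin_le_nhds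
  rw [sub_zero, Real.one_rpow, mul_one] at hlim
  refine le_of_tendsto hlim ?_
  filter_upwards [Ioo_mem_nhdsGT (one_pos : (0 : ℝ) < 1)] with t ht
  have h1 := hmin (Set.mem_univ (v + t • (u - v)))
  simp only [Set.mem_ofPred_eq] at h1
  have h2 := hG.2 (Set.mem_univ v) (Set.mem_univ u) (by linarith [ht.2] : 0 ≤ 1 - t) ht.1.le (by ring)
  have e : (1 - t) • v + t • u = v + t • (u - v) := by module
  rw [e, smul_eq_mul, smul_eq_mul] at h2
  have h3 := mul_le_mul_of_nonneg_left (psi_segment_le hp x₀ v u ht.1.le ht.2.le) hc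
  rw [← hqdef] at h3
  have h4 : 0 ≤ t * (G u + c * psi p x₀ u -
      (G v + c * psi p x₀ v + c * (Z * (1 - t) ^ q * N))) := by
    linarith
  have := nonneg_of_mul_nonneg_right h4 ht.1
  linarith

/-- First-order optimality for `f + lam ψ`: the vector `-∇f(w)` is a subgradient of `lam ψ` at a
minimizer `w`. -/
lemma isMinOn_add_psi_subgradient {d : ℕ} {p lam : ℝ} (hp : 1 < p) (hlam : 0 ≤ lam)
    {x₀ w : Fin d → ℝ} {f : (Fin d → ℝ) → ℝ} (hf : Differentiable ℝ f)
    (hmin : IsMinOn (fun u => f u + lam * psi p x₀ u) Set.univ w) (u : Fin d → ℝ) :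
    0 ≤ grad f w ⬝ᵥ (u - w) + lam * (psi p x₀ u - psi p x₀ w) := by
  have hq := two_le_max p
  have hd := hasDerivAt_line hf w (u - w) 0
  rw [zero_smul, add_zero] at hd
  have hslope := hd.tendsto_slope_zero_right
  have : -(lam * (psi p x₀ u - psi p x₀ w)) ≤ grad f w ⬝ᵥ (u - w) := by
    refine ge_of_tendsto hslope ?_
    filter_upwards [Ioo_mem_nhdsGT (one_pos : (0 : ℝ) < 1)] with t ht
    have h1 := hmin (Set.mem_univ (w + t • (u - w)))
    simp only [Set.mem_ofPred_eq] at h1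
    have h3 := mul_le_mul_of_nonneg_left (psi_segment_le hp x₀ w u ht.1.le ht.2.le) hlam
    have h4 : 0 ≤ lam * (2 ^ (2 - max p 2) / max p 2 * (t * (1 - t) ^ max p 2) *
        lpNorm p (u - w) ^ max p 2) := by
      have := ht.1
      have : 0 < 1 - t := by linarith [ht.2]
      have := lpNorm_nonneg p (u - w)
      positivity
    simp only [zero_add, zero_smul, add_zero, smul_eq_mul]
    rw [← div_eq_inv_mul, le_div_iff₀ ht.1]
    linarith
  linarith

/-- The gradient of `f` at a minimizer of `f + lam ψ` is bounded by the norm of the gradient of the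
regularizer. -/
lemma lpNorm_grad_isMinOn_le {d : ℕ} {p lam : ℝ} (hp : 1 < p) (hlam : 0 ≤ lam)
    {x₀ w : Fin d → ℝ} {f : (Fin d → ℝ) → ℝ} (hf : Differentiable ℝ f)
    (hmin : IsMinOn (fun u => f u + lam * psi p x₀ u) Set.univ w) :
    lpNorm (conjExp p) (grad f w) ≤ lam / psiScale p * lpNorm p (w - x₀) ^ (max p 2 - 1) := by
  have hq := two_le_max p
  have hP := psiScale_pos hp
  set q := max p 2 with hqdef
  set N := lpNorm p (w - x₀) with hN
  have hN0 : 0 ≤ N := lpNorm_nonneg _ _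
  refine lpNorm_conjExp_le_of_forall hp (by positivity) fun h => ?_
  set Z := lpNorm p h with hZ
  have hZ0 : 0 ≤ Z := lpNorm_nonneg _ _
  -- The one-sided difference quotient of the regularizer in the direction `-h` is bounded by that
  -- of `t ↦ (N + t Z) ^ q`.
  have hd : HasDerivAt (fun t : ℝ => lam * (1 / (q * psiScale p) * (N + t * Z) ^ q))
      (lam * (1 / (q * psiScale p) * (Z * q * (N + 0 * Z) ^ (q - 1)))) 0 := by
    have h1 : HasDerivAt (fun t : ℝ => N + t * Z) Z 0 :=
      (((hasDerivAt_id (0 : ℝ)).mul_const Z).const_add N).congr_deriv (one_mul _)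
    exact ((h1.rpow_const (Or.inr (by linarith))).const_mul _).const_mul _
  have hslope := hd.tendsto_slope_zero_right
  have e : lam * (1 / (q * psiScale p) * (Z * q * (N + 0 * Z) ^ (q - 1))) =
      lam / psiScale p * N ^ (q - 1) * Z := by
    rw [zero_mul, add_zero]; field_simp
  rw [e] at hslope
  refine ge_of_tendsto hslope ?_
  filter_upwards [self_mem_nhdsWithin] with t ht
  have ht0 : 0 < t := ht
  have h1 := isMinOn_add_psi_subgradient hp hlam hf hmin (w + (-t) • h)
  rw [add_sub_cancel_left, dotProduct_smul, smul_eq_mul, psi_eq, psi_eq, ← hqdef] at h1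
  have h2 : lpNorm p (w + (-t) • h - x₀) ≤ N + t * Z := by
    rw [add_sub_right_comm]
    refine (lpNorm_add_le hp.le _ _).trans_eq ?_
    rw [lpNorm_smul (by linarith), abs_neg, abs_of_pos ht0]
  have h3 : lpNorm p (w + (-t) • h - x₀) ^ q ≤ (N + t * Z) ^ q :=
    Real.rpow_le_rpow (lpNorm_nonneg _ _) h2 (by linarith)
  have h4 : lam * (1 / (q * psiScale p) * lpNorm p (w + (-t) • h - x₀) ^ q) ≤
      lam * (1 / (q * psiScale p) * (N + t * Z) ^ q) := by
    have : 0 < q := by linarith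
    gcongr
  simp only [zero_add, smul_eq_mul, zero_mul, add_zero]
  rw [← div_eq_inv_mul, le_div_iff₀ ht0]
  linarith

lemma partialSum_succ (a : ℕ → ℝ) (k : ℕ) : partialSum a (k + 1) = partialSum a k + a (k + 1) :=
  sum_range_succ _ _

lemma partialSum_zero (a : ℕ → ℝ) : partialSum a 0 = a 0 := by simp [partialSum]

lemma partialSum_pos {a : ℕ → ℝ} (ha : ∀ k, 0 < a k) (k : ℕ) : 0 < partialSum a k :=
  sum_pos (fun i _ => ha i) ⟨0, by simp⟩

lemma smoothConst_mul {q L κ δ r : ℝ} (hκ : 0 < κ) (hq : κ ≤ q) (hδ : 0 < δ) (hr : 0 < r) :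
    smoothConst q L κ (r * δ) = smoothConst q L κ δ * r ^ (-((q - κ) / κ)) := by
  have hq0 : 0 < q := by linarith
  have hqκ : 0 ≤ q - κ := by linarith
  unfold smoothConst
  rw [show 2 * (q - κ) / (q * κ * (r * δ)) = 2 * (q - κ) / (q * κ * δ) * r⁻¹ by field_simp,
    Real.mul_rpow (by positivity) (by positivity), Real.inv_rpow hr.le, Real.rpow_neg hr.le]
  ring

/-- The increment solving the implicit equation of the step rule exists: after clearing
denominators, the left side grows like `a ^ q` and the right side like `a ^ (q - 1)`. -/
lemma exists_step {q L κ lam acc : ℝ} (hL : 0 < L) (hκ : 0 < κ) (hκ2 : κ ≤ 2) (hκ1 : 1 ≤ κ)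
    (hq : 2 ≤ q) (hlam : 0 < lam) (hacc : 0 < acc) {A : ℝ} (hA : 0 < A) :
    ∃ a : ℝ, 0 < a ∧ a ^ q = 2 ^ (2 - q) *
      max (lam * A ^ q) (smoothConst q L κ acc * (A + a) ^ (q - 1)) /
        smoothConst q L κ (a / (A + a) * acc) := by
  have hκq : κ ≤ q := hκ2.trans hq
  set B := smoothConst q L κ acc with hB
  have hB0 : 0 < B := smoothConst_pos hL hκ hκq hacc
  set r := (q - κ) / κ with hr
  have hr0 : 0 ≤ r := div_nonneg (by linarith) hκ.le
  have hrq : r < q := by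
    rw [hr, div_lt_iff₀ hκ]; nlinarith
  let F : ℝ → ℝ := fun a =>
    B * (a ^ (q - r) * (A + a) ^ r) - 2 ^ (2 - q) * max (lam * A ^ q) (B * (A + a) ^ (q - 1))
  have hFc : Continuous F := by
    have c1 : Continuous fun a : ℝ => a ^ (q - r) :=
      continuous_id.rpow_const fun _ => Or.inr (by linarith)
    have c2 : Continuous fun a : ℝ => (A + a) ^ r :=
      (continuous_const.add continuous_id).rpow_const fun _ => Or.inr hr0
    have c3 : Continuous fun a : ℝ => (A + a) ^ (q - 1) :=
      (continuous_const.add continuous_id).rpow_const fun _ => Or.inr (by linarith)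
    fun_prop
  set b := 2 + A + lam * A ^ q / B with hb
  have hlA : 0 < lam * A ^ q / B := by positivity
  have hb0 : 0 < b := by linarith
  have hF0 : F 0 < 0 := by
    simp only [F]
    rw [Real.zero_rpow (by linarith), zero_mul, mul_zero, zero_sub, neg_lt_zero]
    exact mul_pos (by positivity) (lt_max_of_lt_left (by positivity))
  have hFb : 0 ≤ F b := by
    have h1 : b ^ q ≤ b ^ (q - r) * (A + b) ^ r := by
      calc b ^ q = b ^ (q - r) * b ^ r := by rw [← Real.rpow_add hb0]; congr 1; ring
        _ ≤ _ := by gcongr; linarith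
    have h2 : 2 ^ (2 - q) * (lam * A ^ q) ≤ B * b ^ q := by
      calc 2 ^ (2 - q) * (lam * A ^ q) ≤ 1 * (lam * A ^ q) := by
            gcongr
            exact Real.rpow_le_one_of_one_le_of_nonpos (by norm_num) (by linarith)
        _ = B * (lam * A ^ q / B) := by field_simp
        _ ≤ B * b ^ q := by
            gcongr
            refine le_trans ?_ (Real.self_le_rpow_of_one_le (by linarith) (by linarith : 1 ≤ q))
            linarith
    have h3 : 2 ^ (2 - q) * (B * (A + b) ^ (q - 1)) ≤ B * b ^ q := by
      calc 2 ^ (2 - q) * (B * (A + b) ^ (q - 1)) ≤ 2 ^ (2 - q) * (B * (2 * b) ^ (q - 1)) := by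
            gcongr <;> linarith
        _ = B * (2 ^ (2 - q) * 2 ^ (q - 1) * b ^ (q - 1)) := by
            rw [Real.mul_rpow (by norm_num) hb0.le]; ring
        _ = B * (2 * b ^ (q - 1)) := by
            rw [← Real.rpow_add (by norm_num), show 2 - q + (q - 1) = 1 by ring, Real.rpow_one]
        _ ≤ B * (b * b ^ (q - 1)) := by gcongr; linarith
        _ = B * b ^ q := by
            rw [← Real.rpow_one_add' hb0.le (by linarith)]; congr 2; ring
    have h4 : 2 ^ (2 - q) * max (lam * A ^ q) (B * (A + b) ^ (q - 1)) ≤ B * b ^ q := by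
      rw [mul_max_of_nonneg _ _ (by positivity)]
      exact max_le h2 h3
    have h5 : B * b ^ q ≤ B * (b ^ (q - r) * (A + b) ^ r) := by gcongr
    simp only [F]
    linarith
  obtain ⟨a, ha, hFa⟩ := intermediate_value_Icc hb0.le hFc.continuousOn ⟨hF0.le, hFb⟩
  have ha0 : 0 < a := by
    rcases ha.1.eq_or_lt with h | h
    · rw [← h] at hFa; exact absurd hFa hF0.ne
    · exact h
  refine ⟨a, ha0, ?_⟩
  have hAa : 0 < A + a := by linarith
  rw [smoothConst_mul hκ hκq hacc (by positivity), ← hB, ← hr, Real.rpow_neg (by positivity),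
    Real.div_rpow ha0.le hAa.le, eq_div_iff (by positivity)]
  simp only [F, Real.rpow_sub ha0 q r] at hFa
  have har : 0 < a ^ r := Real.rpow_pos_of_pos ha0 _
  have hAar : 0 < (A + a) ^ r := Real.rpow_pos_of_pos hAa _
  rw [inv_div, ← sub_eq_zero, ← hFa]
  field_simp

/-- The parameters of the algorithm exist. -/
lemma exists_isStepRule {q L κ lam acc : ℝ} (hL : 0 < L) (hκ : 1 < κ) (hκ2 : κ ≤ 2)
    (hq : 2 ≤ q) (hlam : 0 < lam) (hacc : 0 < acc) :
    ∃ m₀ a, IsStepRule q L κ lam (2 ^ (2 - q)) acc m₀ a := by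
  have hex : ∀ A : ℝ, ∃ a : ℝ, 0 < A → 0 < a ∧ a ^ q = 2 ^ (2 - q) *
      max (lam * A ^ q) (smoothConst q L κ acc * (A + a) ^ (q - 1)) /
        smoothConst q L κ (a / (A + a) * acc) := by
    intro A
    by_cases hA : 0 < A
    · obtain ⟨a, ha⟩ := exists_step hL (by linarith) hκ2 hκ.le hq hlam hacc hA
      exact ⟨a, fun _ => ha⟩
    · exact ⟨0, fun h => absurd h hA⟩
  choose next hnext using hex
  let A : ℕ → ℝ := fun k => Nat.rec 1 (fun _ s => s + next s) k
  have hA1 : ∀ k, A (k + 1) = A k + next (A k) := fun k => rfl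
  have hApos : ∀ k, 0 < A k := by
    intro k
    induction k with
    | zero => exact one_pos
    | succ k ih => rw [hA1]; linarith [(hnext _ ih).1]
  let a : ℕ → ℝ := fun k => Nat.casesOn k 1 fun j => next (A j)
  have hsum : ∀ k, partialSum a k = A k := by
    intro k
    induction k with
    | zero => exact partialSum_zero a
    | succ k ih => rw [partialSum_succ, ih, hA1]
  refine ⟨partialSum a 0 * stepConst q L κ acc a 0, a, ?_, rfl, rfl, ?_⟩
  · intro k
    cases k with
    | zero => exact one_pos
    | succ k => exact (hnext _ (hApos k)).1
  · intro k
    have h0 : partialSum a 0 = 1 := hsum 0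
    have ha0 : a 0 = 1 := rfl
    have := (hnext _ (hApos k)).2
    rw [stepConst, stepConst, h0, ha0, hsum, hsum, hA1, div_one, one_mul, one_mul]
    exact this

lemma modelFun_eq {d : ℕ} (f : (Fin d → ℝ) → ℝ) (φ : (Fin d → ℝ) → ℝ) (lam m₀ : ℝ) (a : ℕ → ℝ)
    (x : ℕ → Fin d → ℝ) (k : ℕ) (u : Fin d → ℝ) :
    modelFun f (fun u => lam * φ u) φ m₀ a x k u =
      (∑ i ∈ range (k + 1), a i * (grad f (x i) ⬝ᵥ (u - x i))) +
        (partialSum a k * lam + m₀) * φ u := by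
  unfold modelFun; ring

/-- The iterates exist for every choice of the parameters. -/
lemma exists_isRun {d : ℕ} {p lam m₀ : ℝ} (hp : 1 < p) (hlam : 0 < lam) (hm : 0 < m₀)
    (f : (Fin d → ℝ) → ℝ) (x₀ : Fin d → ℝ) {a : ℕ → ℝ} (ha : ∀ k, 0 < a k) :
    ∃ x v y, IsRun Set.univ f (fun u => lam * psi p x₀ u) (psi p x₀) m₀ a x₀ x v y := by
  have hex : ∀ (g : Fin d → ℝ) (c : ℝ), ∃ v : Fin d → ℝ, 0 < c →
      IsMinOn (fun u => g ⬝ᵥ u + c * psi p x₀ u) Set.univ v := by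
    intro g c
    by_cases hc : 0 < c
    · obtain ⟨v, hv⟩ := exists_isMinOn_add_psi hp hc x₀ (G := fun u => g ⬝ᵥ u)
        (b := lpNorm (conjExp p) g) (e := g ⬝ᵥ x₀) (by unfold dotProduct; fun_prop)
        (lpNorm_nonneg _ _) fun u => by
          have := dotProduct_le_lpNorm hp g (x₀ - u)
          rw [dotProduct_sub, lpNorm_sub_comm] at this
          linarith
      exact ⟨v, fun _ => hv⟩
    · exact ⟨0, fun h => absurd h hc⟩
  choose V hV using hex
  have hc : ∀ k, 0 < partialSum a k * lam + m₀ := fun k => by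
    have := partialSum_pos ha k
    positivity
  -- The state holds the accumulated gradient, `v` and `y`.
  let nx : ℕ → (Fin d → ℝ) × (Fin d → ℝ) × (Fin d → ℝ) → Fin d → ℝ := fun k s =>
    (partialSum a k / partialSum a (k + 1)) • s.2.2 + (a (k + 1) / partialSum a (k + 1)) • s.2.1
  let nv : ℕ → (Fin d → ℝ) × (Fin d → ℝ) × (Fin d → ℝ) → Fin d → ℝ := fun k s =>
    V (s.1 + a (k + 1) • grad f (nx k s)) (partialSum a (k + 1) * lam + m₀)
  let v0 : Fin d → ℝ := V (a 0 • grad f x₀) (partialSum a 0 * lam + m₀)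
  let st : ℕ → (Fin d → ℝ) × (Fin d → ℝ) × (Fin d → ℝ) := fun k =>
    Nat.rec (a 0 • grad f x₀, v0, v0) (fun k s => (s.1 + a (k + 1) • grad f (nx k s), nv k s,
      (partialSum a k / partialSum a (k + 1)) • s.2.2 +
        (a (k + 1) / partialSum a (k + 1)) • nv k s)) k
  let x : ℕ → Fin d → ℝ := fun k => Nat.casesOn k x₀ fun j => nx j (st j)
  have hS : ∀ k, (st k).1 = ∑ i ∈ range (k + 1), a i • grad f (x i) := by
    intro k
    induction k with
    | zero => simp [st, x]
    | succ k ih => rw [sum_range_succ, ← ih]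
  refine ⟨x, fun k => (st k).2.1, fun k => (st k).2.2, Set.mem_univ _, rfl, rfl,
    fun _ => Set.mem_univ _, ?_, fun _ => rfl, fun _ => rfl⟩
  intro k
  have hv : (st k).2.1 = V (st k).1 (partialSum a k * lam + m₀) := by
    cases k <;> rfl
  have hmin := hV (st k).1 _ (hc k)
  rw [← hv] at hmin
  have hmodel : ∀ u, modelFun f (fun u => lam * psi p x₀ u) (psi p x₀) m₀ a x k u =
      ((st k).1 ⬝ᵥ u + (partialSum a k * lam + m₀) * psi p x₀ u) -
        ∑ i ∈ range (k + 1), a i * (grad f (x i) ⬝ᵥ x i) := by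
    intro u
    rw [modelFun_eq, hS, sum_dotProduct]
    simp only [dotProduct_sub, mul_sub, sum_sub_distrib, smul_dotProduct, smul_eq_mul]
    ring
  intro u hu
  have := hmin hu
  simp only [Set.mem_ofPred_eq] at this ⊢
  rw [hmodel, hmodel]
  linarith

/-! ### Convergence in function value and in gradient norm -/

lemma convexOn_psi {d : ℕ} {p : ℝ} (hp : 1 < p) (x₀ : Fin d → ℝ) :
    ConvexOn ℝ Set.univ (psi p x₀) := by
  refine ⟨convex_univ, fun x _ y _ s t hs ht hst => ?_⟩
  have h := psi_segment_le hp x₀ x y ht (by linarith)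
  have hq := two_le_max p
  have h4 : 0 ≤ 2 ^ (2 - max p 2) / max p 2 * (t * (1 - t) ^ max p 2) *
      lpNorm p (y - x) ^ max p 2 := by
    have : 0 ≤ 1 - t := by linarith
    have := lpNorm_nonneg p (y - x)
    positivity
  obtain rfl : s = 1 - t := by linarith
  have e : (1 - t) • x + t • y = x + t • (y - x) := by module
  rw [e, smul_eq_mul, smul_eq_mul]
  linarith

/-- The linear part of the function minimized in iteration `k`. -/
noncomputable def modelLinear {d : ℕ} (f : (Fin d → ℝ) → ℝ) (a : ℕ → ℝ) (x : ℕ → Fin d → ℝ) (k : ℕ)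
    (u : Fin d → ℝ) : ℝ :=
  ∑ i ∈ range (k + 1), a i * (grad f (x i) ⬝ᵥ (u - x i))

lemma convexOn_modelLinear {d : ℕ} (f : (Fin d → ℝ) → ℝ) (a : ℕ → ℝ) (x : ℕ → Fin d → ℝ) (k : ℕ) :
    ConvexOn ℝ Set.univ (modelLinear f a x k) := by
  refine ⟨convex_univ, fun u _ v _ s t _ _ hst => le_of_eq ?_⟩
  unfold modelLinear
  rw [smul_eq_mul, smul_eq_mul, mul_sum, mul_sum, ← sum_add_distrib]
  refine sum_congr rfl fun i _ => ?_
  obtain rfl : s = 1 - t := by linarith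
  have e : (1 - t) • u + t • v - x i = (1 - t) • (u - x i) + t • (v - x i) := by module
  rw [e, dotProduct_add, dotProduct_smul, dotProduct_smul, smul_eq_mul, smul_eq_mul]
  ring

lemma IsRun.isMinOn {d : ℕ} {p lam m₀ : ℝ} {f : (Fin d → ℝ) → ℝ} {a : ℕ → ℝ} {x₀ : Fin d → ℝ}
    {x v y : ℕ → Fin d → ℝ}
    (h : IsRun Set.univ f (fun u => lam * psi p x₀ u) (psi p x₀) m₀ a x₀ x v y) (k : ℕ) :
    IsMinOn (fun u => modelLinear f a x k u + (partialSum a k * lam + m₀) * psi p x₀ u)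
      Set.univ (v k) := by
  have := h.v_argmin k
  have e : modelFun f (fun u => lam * psi p x₀ u) (psi p x₀) m₀ a x k =
      fun u => modelLinear f a x k u + (partialSum a k * lam + m₀) * psi p x₀ u :=
    funext fun u => modelFun_eq f _ lam m₀ a x k u
  rwa [e] at this

lemma IsStepRule.m_eq_smoothConst {q L κ lam σ acc m₀ : ℝ} {a : ℕ → ℝ}
    (h : IsStepRule q L κ lam σ acc m₀ a) : m₀ = smoothConst q L κ acc := by
  rw [h.m_eq, stepConst, partialSum_zero, h.zero, div_one, one_mul, one_mul]

/-- The step rule lets the curvature of the model absorb the smoothness error. -/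
lemma IsStepRule.smoothness_le_curvature {q L κ lam σ acc m₀ : ℝ} {a : ℕ → ℝ} (hq : 2 ≤ q)
    (hσ : 0 < σ) (hlam : 0 < lam) (hm : 0 < m₀) (h : IsStepRule q L κ lam σ acc m₀ a) (k : ℕ)
    (hM : 0 < stepConst q L κ acc a (k + 1)) :
    partialSum a (k + 1) * (stepConst q L κ acc a (k + 1) *
      (a (k + 1) / partialSum a (k + 1)) ^ q) ≤ (partialSum a k * lam + m₀) * σ := by
  have hA := partialSum_pos h.pos k
  have hA' := partialSum_pos h.pos (k + 1)
  have hle : partialSum a k ≤ partialSum a (k + 1) := by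
    rw [partialSum_succ]; linarith [h.pos (k + 1)]
  set M := stepConst q L κ acc a (k + 1)
  set A := partialSum a k
  set A' := partialSum a (k + 1)
  have h1 : M * a (k + 1) ^ q = σ * max (lam * A ^ q) (m₀ * A' ^ (q - 1)) := by
    rw [h.step k]; exact mul_div_cancel₀ _ hM.ne'
  have h2 : max (lam * A ^ q) (m₀ * A' ^ (q - 1)) ≤ (A * lam + m₀) * A' ^ (q - 1) := by
    have e : A ^ q = A * A ^ (q - 1) := by
      rw [← Real.rpow_one_add' hA.le (by linarith)]; congr 1; ring
    have h3 : A ^ (q - 1) ≤ A' ^ (q - 1) := Real.rpow_le_rpow hA.le hle (by linarith)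
    have h5 : lam * A ^ q ≤ A * lam * A' ^ (q - 1) := by
      rw [e]
      calc lam * (A * A ^ (q - 1)) = A * lam * A ^ (q - 1) := by ring
        _ ≤ _ := by gcongr
    have h6 : 0 ≤ A * lam * A' ^ (q - 1) := by positivity
    have h7 : 0 ≤ m₀ * A' ^ (q - 1) := by positivity
    rw [add_mul]
    exact max_le (by linarith) (by linarith)
  have hA'q : 0 < A' ^ (q - 1) := Real.rpow_pos_of_pos hA' _
  have h4 : A' * (M * (a (k + 1) / A') ^ q) = M * a (k + 1) ^ q / A' ^ (q - 1) := by
    rw [Real.div_rpow (h.pos _).le hA'.le, Real.rpow_sub_one hA'.ne']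
    field_simp
  rw [h4, h1, div_le_iff₀ hA'q]
  calc σ * max (lam * A ^ q) (m₀ * A' ^ (q - 1)) ≤ σ * ((A * lam + m₀) * A' ^ (q - 1)) := by
        gcongr
    _ = _ := by ring

/-- The invariant of the method: the objective at `y_k` stays below the minimum of the lower model,
up to half of the target accuracy. -/
lemma IsRun.objective_le_model {d : ℕ} {p L κ lam acc m₀ : ℝ} {f : (Fin d → ℝ) → ℝ} {a : ℕ → ℝ}
    {x₀ : Fin d → ℝ} {x v y : ℕ → Fin d → ℝ} (hp : 1 < p) (hL : 0 < L) (hκ : 1 < κ) (hκ2 : κ ≤ 2)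
    (hlam : 0 < lam) (hacc : 0 < acc) (hc : ConvexOn ℝ Set.univ f) (hf : WeaklySmooth p L κ f)
    (ha : IsStepRule (max p 2) L κ lam (2 ^ (2 - max p 2)) acc m₀ a)
    (h : IsRun Set.univ f (fun u => lam * psi p x₀ u) (psi p x₀) m₀ a x₀ x v y) (k : ℕ) :
    partialSum a k * (f (y k) + lam * psi p x₀ (y k)) ≤
      ∑ i ∈ range (k + 1), a i * f (x i) + (modelLinear f a x k (v k) +
        (partialSum a k * lam + m₀) * psi p x₀ (v k)) + partialSum a k * (acc / 2) := by
  have hq := two_le_max p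
  have hm : 0 < m₀ := by
    rw [ha.m_eq_smoothConst]
    exact smoothConst_pos hL (by linarith) (hκ2.trans hq) hacc
  have hmodel : ∀ (δ : ℝ) (z u : Fin d → ℝ), 0 < δ → f u ≤ f z + grad f z ⬝ᵥ (u - z) +
      (smoothConst (max p 2) L κ δ / max p 2 * lpNorm p (u - z) ^ max p 2 + δ / 2) := by
    intro δ z u hδ
    have h1 := hf.le_linearization_add hp hκ z u
    have h2 := rpow_le_smoothConst_mul_rpow_add hL (by linarith : 0 < κ) (hκ2.trans hq) hδ
      (lpNorm_nonneg p (u - z))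
    linarith
  induction k with
  | zero =>
    have h1 := hmodel acc x₀ (v 0) hacc
    have h2 := mul_le_mul_of_nonneg_left (rpow_div_le_psi hp x₀ (v 0)) hm.le
    rw [ha.m_eq_smoothConst] at h2 ⊢
    simp only [modelLinear, zero_add, range_one, sum_singleton, partialSum_zero, ha.zero,
      h.start, h.y_zero, one_mul]
    have e : smoothConst (max p 2) L κ acc / max p 2 * lpNorm p (v 0 - x₀) ^ max p 2 =
      smoothConst (max p 2) L κ acc * (1 / max p 2 * lpNorm p (v 0 - x₀) ^ max p 2) := by ring
    linarith
  | succ k ih =>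
    have hA := partialSum_pos ha.pos k
    have hA' := partialSum_pos ha.pos (k + 1)
    have hα := ha.pos (k + 1)
    have hAA := partialSum_succ a k
    have hδ : 0 < a (k + 1) / partialSum a (k + 1) * acc := by positivity
    have hM : 0 < stepConst (max p 2) L κ acc a (k + 1) :=
      smoothConst_pos hL (by linarith) (hκ2.trans hq) hδ
    have hcurv := ha.smoothness_le_curvature hq (by positivity) hlam hm k hM
    have hgrow := isMinOn_add_psi_growth hp (by positivity) (convexOn_modelLinear f a x k)
      (h.isMinOn k) (v (k + 1))
    have hsm := hmodel _ (x (k + 1)) (y (k + 1)) hδ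
    have hlow := add_grad_dotProduct_le hf.1 hc (x (k + 1)) (y k)
    have hψ := (convexOn_psi hp x₀).2 (Set.mem_univ (y k)) (Set.mem_univ (v (k + 1)))
      (by positivity : 0 ≤ partialSum a k / partialSum a (k + 1))
      (by positivity : 0 ≤ a (k + 1) / partialSum a (k + 1))
      (by rw [← add_div, ← hAA, div_self hA'.ne'])
    rw [← h.y_step, smul_eq_mul, smul_eq_mul] at hψ
    have hyx : y (k + 1) - x (k + 1) = (a (k + 1) / partialSum a (k + 1)) • (v (k + 1) - v k) := by
      rw [h.y_step, h.x_step, smul_sub]; abel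
    have hlin : partialSum a (k + 1) * (grad f (x (k + 1)) ⬝ᵥ (y (k + 1) - x (k + 1))) =
        partialSum a k * (grad f (x (k + 1)) ⬝ᵥ (y k - x (k + 1))) +
          a (k + 1) * (grad f (x (k + 1)) ⬝ᵥ (v (k + 1) - x (k + 1))) := by
      simp only [dotProduct_sub, h.y_step, dotProduct_add, dotProduct_smul, smul_eq_mul]
      rw [hAA] at hA' ⊢
      field_simp
      ring
    have hnorm : lpNorm p (y (k + 1) - x (k + 1)) ^ max p 2 =
        (a (k + 1) / partialSum a (k + 1)) ^ max p 2 * lpNorm p (v (k + 1) - v k) ^ max p 2 := by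
      rw [hyx, lpNorm_smul (by linarith), abs_of_pos (by positivity),
        Real.mul_rpow (by positivity) (lpNorm_nonneg _ _)]
    rw [hnorm] at hsm
    have hsum : ∑ i ∈ range (k + 1 + 1), a i * f (x i) =
        ∑ i ∈ range (k + 1), a i * f (x i) + a (k + 1) * f (x (k + 1)) := sum_range_succ _ _
    have hmod : modelLinear f a x (k + 1) (v (k + 1)) = modelLinear f a x k (v (k + 1)) +
        a (k + 1) * (grad f (x (k + 1)) ⬝ᵥ (v (k + 1) - x (k + 1))) := sum_range_succ _ _
    rw [hsum, hmod]
    change f (y (k + 1)) ≤ f (x (k + 1)) + grad f (x (k + 1)) ⬝ᵥ (y (k + 1) - x (k + 1)) +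
      (stepConst (max p 2) L κ acc a (k + 1) / max p 2 *
        ((a (k + 1) / partialSum a (k + 1)) ^ max p 2 * lpNorm p (v (k + 1) - v k) ^ max p 2) +
        a (k + 1) / partialSum a (k + 1) * acc / 2) at hsm
    set M := stepConst (max p 2) L κ acc a (k + 1)
    set A := partialSum a k
    set A' := partialSum a (k + 1)
    set α := a (k + 1)
    set Z := lpNorm p (v (k + 1) - v k) ^ max p 2
    have hZ : 0 ≤ Z := Real.rpow_nonneg (lpNorm_nonneg _ _) _
    have s1 := mul_le_mul_of_nonneg_left hsm hA'.le
    have s2 := mul_le_mul_of_nonneg_left hlow hA.le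
    have s3 := mul_le_mul_of_nonneg_left hψ (mul_nonneg hA'.le hlam.le)
    have s4 := mul_le_mul_of_nonneg_right hcurv (by positivity : 0 ≤ Z / max p 2)
    have e1 : A' * lam * (A / A' * psi p x₀ (y k) + α / A' * psi p x₀ (v (k + 1))) =
        A * lam * psi p x₀ (y k) + α * lam * psi p x₀ (v (k + 1)) := by field_simp
    have e2 : A' * (α / A' * acc / 2) = α * (acc / 2) := by field_simp
    have e3 : A' * (M * (α / A') ^ max p 2) * (Z / max p 2) =
        A' * (M / max p 2 * ((α / A') ^ max p 2 * Z)) := by ring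
    have e4 : (A * lam + m₀) * 2 ^ (2 - max p 2) * (Z / max p 2) =
        (A * lam + m₀) * (2 ^ (2 - max p 2) / max p 2 * Z) := by ring
    rw [e1] at s3
    rw [e3, e4] at s4
    rw [mul_add A', mul_add A', mul_add A', hlin, e2] at s1
    rw [hAA] at s1 s3 s4 ⊢
    linarith

/-- Convergence in function value, relative to an arbitrary comparison point `u`. -/
lemma IsRun.objective_le {d : ℕ} {p L κ lam acc m₀ : ℝ} {f : (Fin d → ℝ) → ℝ} {a : ℕ → ℝ}
    {x₀ : Fin d → ℝ} {x v y : ℕ → Fin d → ℝ} (hp : 1 < p) (hL : 0 < L) (hκ : 1 < κ) (hκ2 : κ ≤ 2)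
    (hlam : 0 < lam) (hacc : 0 < acc) (hc : ConvexOn ℝ Set.univ f) (hf : WeaklySmooth p L κ f)
    (ha : IsStepRule (max p 2) L κ lam (2 ^ (2 - max p 2)) acc m₀ a)
    (h : IsRun Set.univ f (fun u => lam * psi p x₀ u) (psi p x₀) m₀ a x₀ x v y) (k : ℕ)
    (u : Fin d → ℝ) :
    partialSum a k * (f (y k) + lam * psi p x₀ (y k)) ≤
      partialSum a k * (f u + lam * psi p x₀ u) + m₀ * psi p x₀ u +
        partialSum a k * (acc / 2) := by
  have h1 := h.objective_le_model hp hL hκ hκ2 hlam hacc hc hf ha k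
  have h2 := (h.isMinOn k) (Set.mem_univ u)
  simp only [Set.mem_ofPred_eq] at h2
  have h3 : ∑ i ∈ range (k + 1), a i * f (x i) + modelLinear f a x k u ≤ partialSum a k * f u := by
    rw [modelLinear, ← sum_add_distrib, partialSum, sum_mul]
    refine sum_le_sum fun i _ => ?_
    rw [← mul_add]
    exact mul_le_mul_of_nonneg_left (add_grad_dotProduct_le hf.1 hc _ _) (ha.pos i).le
  linarith

/-- Once the weights `A_k` have grown enough, the gradient at `y_k` is small: it is compared with
the gradient at the minimizer of the regularized objective, which is at most as far from `x₀` as the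
minimizer of `f`. -/
lemma IsRun.lpNorm_grad_le {d : ℕ} {p L κ ε R m₀ : ℝ} {f : (Fin d → ℝ) → ℝ} {a : ℕ → ℝ}
    {x₀ xstar : Fin d → ℝ} {x v y : ℕ → Fin d → ℝ} (hp : 1 < p) (hL : 0 < L) (hκ : 1 < κ)
    (hκ2 : κ ≤ 2) (hε : 0 < ε) (hc : ConvexOn ℝ Set.univ f) (hf : WeaklySmooth p L κ f)
    (hmin : IsMinOn f Set.univ xstar) (hR0 : 0 < R) (hR : R = lpNorm p (xstar - x₀))
    (ha : IsStepRule (max p 2) L κ (regParam p ε R) (2 ^ (2 - max p 2)) (valueAcc L κ ε) m₀ a)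
    (h : IsRun Set.univ f (fun u => regParam p ε R * psi p x₀ u) (psi p x₀) m₀ a x₀ x v y)
    {k : ℕ} (hk : 2 * m₀ * (1 / (max p 2 * psiScale p) * R ^ max p 2) ≤
      partialSum a k * valueAcc L κ ε) :
    lpNorm (conjExp p) (grad f (y k)) ≤ ε := by
  have hq := two_le_max p
  have hP := psiScale_pos hp
  have hacc := valueAcc_pos hL hκ hε
  have hA := partialSum_pos ha.pos k
  have hm : 0 < m₀ := by
    rw [ha.m_eq_smoothConst]
    exact smoothConst_pos hL (by linarith) (hκ2.trans hq) hacc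
  have hlam : 0 < regParam p ε R := by rw [regParam_eq]; positivity
  obtain ⟨w, hw⟩ := exists_isMinOn_add_psi hp hlam x₀ hf.1.continuous le_rfl (e := f xstar)
    fun u => by
      have := hmin (Set.mem_univ u)
      simp only [Set.mem_ofPred_eq] at this
      linarith
  have hψle : psi p x₀ w ≤ psi p x₀ xstar := by
    have h1 := hw (Set.mem_univ xstar)
    have h2 := hmin (Set.mem_univ w)
    simp only [Set.mem_ofPred_eq] at h1 h2
    exact le_of_mul_le_mul_left (by linarith) hlam
  have hwR : lpNorm p (w - x₀) ≤ R := by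
    rw [psi_eq, psi_eq, ← hR] at hψle
    exact (Real.rpow_le_rpow_iff (lpNorm_nonneg _ _) hR0.le (by linarith)).1
      (le_of_mul_le_mul_left hψle (by positivity))
  have hgw : lpNorm (conjExp p) (grad f w) ≤ ε / 2 := by
    refine (lpNorm_grad_isMinOn_le hp hlam.le hf.1 hw).trans ?_
    calc regParam p ε R / psiScale p * lpNorm p (w - x₀) ^ (max p 2 - 1)
        ≤ regParam p ε R / psiScale p * R ^ (max p 2 - 1) := by
          gcongr
          · exact lpNorm_nonneg _ _
          · linarith
      _ = ε / 2 := by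
          have := Real.rpow_pos_of_pos hR0 (max p 2 - 1)
          rw [regParam_eq]; field_simp
  have hval := h.objective_le hp hL hκ hκ2 hlam hacc hc hf ha k w
  have hgap : f (y k) - f w - grad f w ⬝ᵥ (y k - w) ≤ valueAcc L κ ε := by
    have hsub := isMinOn_add_psi_subgradient hp hlam.le hf.1 hw (y k)
    have h1 : m₀ * psi p x₀ w ≤ partialSum a k * (valueAcc L κ ε / 2) := by
      have := mul_le_mul_of_nonneg_left hψle hm.le
      rw [psi_eq p x₀ xstar, ← hR] at this
      linarith
    have h2 : partialSum a k * (f (y k) + regParam p ε R * psi p x₀ (y k)) ≤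
        partialSum a k * (f w + regParam p ε R * psi p x₀ w + valueAcc L κ ε) := by linarith
    have h3 := le_of_mul_le_mul_left h2 hA
    linarith
  have hdiff := hf.lpNorm_grad_sub_le hp hL hκ hε hc hgap
  have : grad f (y k) = (grad f (y k) - grad f w) + grad f w := by abel
  rw [this]
  have hconj := (holderConjugate_conjExp hp).symm.lt
  linarith [lpNorm_add_le hconj.le (grad f (y k) - grad f w) (grad f w)]

/-! ### Growth of the weights and the iteration count -/

lemma log_valueAcc {L κ ε : ℝ} (hL : 0 < L) (hκ : 1 < κ) (hε : 0 < ε) :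
    Real.log (valueAcc L κ ε) = κ / (κ - 1) * (Real.log ε - Real.log 2) + Real.log (κ - 1) -
      1 / (κ - 1) * Real.log L - Real.log κ := by
  have hw : 0 < κ - 1 := by linarith
  have hκ0 : 0 < κ := by linarith
  unfold valueAcc
  rw [Real.log_div (by positivity) (by positivity), Real.log_mul (by positivity) (by positivity),
    Real.log_mul (by positivity) (by positivity), Real.log_rpow (by positivity),
    Real.log_rpow hL, Real.log_div (by positivity) (by positivity)]
  ring

/-- The part of `smoothConst` that depends on the exponents only. -/
noncomputable def expConst (q κ : ℝ) : ℝ := (2 * (q - κ) / q) ^ ((q - κ) / κ)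

lemma expConst_pos {q κ : ℝ} (hκ : 0 < κ) (hq : κ ≤ q) : 0 < expConst q κ := by
  have hq0 : 0 < q := by linarith
  unfold expConst
  rcases hq.eq_or_lt with rfl | h
  · simp
  · have : 0 < q - κ := by linarith
    positivity

/-- The exponential constant stays away from `0` and `∞`, since `y ^ y` does near `y = 0`. -/
lemma abs_log_expConst_le {q κ : ℝ} (hκ : 1 < κ) (hκ2 : κ ≤ 2) (hq : 2 ≤ q) :
    |Real.log (expConst q κ)| ≤ q := by
  have hκ0 : 0 < κ := by linarith
  have hq0 : 0 < q := by linarith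
  unfold expConst
  rcases (hκ2.trans hq).eq_or_lt with rfl | h
  · simp [hκ0.le]
  have h0 : 0 < q - κ := by linarith
  set y := 2 * (q - κ) / q with hy
  have hy0 : 0 < y := by positivity
  have hy2 : y ≤ 2 := by rw [hy, div_le_iff₀ hq0]; linarith
  rw [Real.log_rpow hy0]
  have hr : (q - κ) / κ = y * (q / (2 * κ)) := by rw [hy]; field_simp
  have hlow : -1 ≤ y * Real.log y := by
    have := Real.one_sub_inv_le_log_of_pos hy0
    have h1 := mul_le_mul_of_nonneg_left this hy0.le
    have : y * (1 - y⁻¹) = y - 1 := by field_simp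
    linarith
  have hup : Real.log y ≤ 1 := by
    have := Real.log_le_sub_one_of_pos hy0
    linarith
  rw [abs_le]
  constructor
  · rw [hr]
    have hc : q / (2 * κ) ≤ q := div_le_self hq0.le (by linarith)
    have hc0 : 0 ≤ q / (2 * κ) := by positivity
    nlinarith
  · have hr0 : 0 ≤ (q - κ) / κ := by positivity
    have hrq : (q - κ) / κ ≤ q := by rw [div_le_iff₀ hκ0]; nlinarith
    nlinarith

lemma log_smoothConst_valueAcc {q L κ ε : ℝ} (hL : 0 < L) (hκ : 1 < κ) (hq : κ ≤ q)
    (hε : 0 < ε) :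
    Real.log (smoothConst q L κ (valueAcc L κ ε)) = Real.log (expConst q κ) -
      (q - κ) / κ * (Real.log κ + Real.log (valueAcc L κ ε)) + q / κ * Real.log L := by
  have hκ0 : 0 < κ := by linarith
  have hq0 : 0 < q := by linarith
  have hacc := valueAcc_pos hL hκ hε
  have hqκ : 0 ≤ q - κ := by linarith
  have hc := expConst_pos hκ0 hq
  have e : smoothConst q L κ (valueAcc L κ ε) =
      expConst q κ * (κ * valueAcc L κ ε)⁻¹ ^ ((q - κ) / κ) * L ^ (q / κ) := by
    rw [expConst, smoothConst, ← Real.mul_rpow (by positivity) (by positivity)]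
    congr 2
    field_simp
  rw [e, Real.log_mul (by positivity) (by positivity), Real.log_mul (by positivity) (by positivity),
    Real.log_rpow (by positivity), Real.log_rpow hL, Real.log_inv,
    Real.log_mul (by positivity) (by positivity)]
  ring

lemma log_two_mul_condition {L κ ε R : ℝ} (hL : 0 < L) (hε : 0 < ε) (hR : 0 < R) :
    Real.log (2 * (L * R ^ (κ - 1) / ε)) =
      Real.log 2 + Real.log L + (κ - 1) * Real.log R - Real.log ε := by
  rw [Real.log_mul (by positivity) (by positivity), Real.log_div (by positivity) (by positivity),
    Real.log_mul (by positivity) (by positivity), Real.log_rpow hR]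
  ring

/-- The logarithm of the ratio of the smoothness constant to the regularization parameter. This
ratio is the effective condition number of the regularized problem. -/
lemma log_condition {q L κ ε R P : ℝ} (hL : 0 < L) (hκ : 1 < κ) (hq : κ ≤ q)
    (hε : 0 < ε) (hR : 0 < R) (hP : 0 < P) :
    Real.log (smoothConst q L κ (valueAcc L κ ε) / (ε * P / (2 * R ^ (q - 1)))) =
      Real.log (expConst q κ) - (q - κ) / κ * Real.log (κ - 1) +
        (q - 1) / (κ - 1) * Real.log (2 * (L * R ^ (κ - 1) / ε)) - Real.log P := by
  have hκ0 : 0 < κ := by linarith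
  have hw : κ - 1 ≠ 0 := by linarith
  have hB := smoothConst_pos hL hκ0 hq (valueAcc_pos hL hκ hε)
  rw [Real.log_div hB.ne' (by positivity), log_smoothConst_valueAcc hL hκ hq hε,
    log_valueAcc hL hκ hε, log_two_mul_condition hL hε hR,
    Real.log_div (by positivity) (by positivity),
    Real.log_mul hε.ne' hP.ne', Real.log_mul (by norm_num) (by positivity), Real.log_rpow hR]
  field_simp
  ring

/-- The logarithm of the weight `A_k` that guarantees the target accuracy. -/
lemma log_target {q L κ ε R P : ℝ} (hL : 0 < L) (hκ : 1 < κ) (hq : κ ≤ q)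
    (hε : 0 < ε) (hR : 0 < R) (hP : 0 < P) :
    Real.log (2 * smoothConst q L κ (valueAcc L κ ε) * (1 / (q * P) * R ^ q) / valueAcc L κ ε) =
      Real.log (2 * κ / q) + Real.log (expConst q κ) - q / κ * Real.log (κ - 1) +
        q / (κ - 1) * Real.log (2 * (L * R ^ (κ - 1) / ε)) - Real.log P := by
  have hκ0 : 0 < κ := by linarith
  have hq0 : 0 < q := by linarith
  have hw : κ - 1 ≠ 0 := by linarith
  have hacc := valueAcc_pos hL hκ hε
  have hB := smoothConst_pos hL hκ0 hq hacc
  rw [Real.log_div (by positivity) hacc.ne', Real.log_mul (by positivity) (by positivity),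
    Real.log_mul (by positivity) (by positivity), Real.log_mul (by positivity) (by positivity),
    log_smoothConst_valueAcc hL hκ hq hε, log_valueAcc hL hκ hε, log_two_mul_condition hL hε hR,
    Real.log_div (by positivity) (by positivity), Real.log_div (by positivity) (by positivity),
    Real.log_mul (by positivity) (by positivity), Real.log_mul (by positivity) (by positivity),
    Real.log_rpow hR, Real.log_one]
  field_simp
  ring

lemma neg_mul_log_le_one {w : ℝ} (hw : 0 < w) : w * -Real.log w ≤ 1 := by
  have h1 := Real.one_sub_inv_le_log_of_pos hw
  have h2 := mul_le_mul_of_nonneg_left h1 hw.le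
  have : w * (1 - w⁻¹) = w - 1 := by field_simp
  linarith

/-- The exponent of the condition number in the iteration count. -/
noncomputable def rateExp (q κ : ℝ) : ℝ := κ / (q * κ - q + κ)

lemma rateExp_pos {q κ : ℝ} (hκ : 1 < κ) (hq : 2 ≤ q) : 0 < rateExp q κ := by
  unfold rateExp
  have : 0 < q * κ - q + κ := by nlinarith
  exact div_pos (by linarith) this

lemma rateExp_le_one {q κ : ℝ} (hκ : 1 < κ) (hq : 2 ≤ q) : rateExp q κ ≤ 1 := by
  unfold rateExp
  have : 0 < q * κ - q + κ := by nlinarith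
  rw [div_le_one this]; nlinarith

/-- The step rule makes the weights grow geometrically, with a ratio governed by the condition
number `ρ`. Only the term of the rule coming from the regularization is used. -/
lemma IsStepRule.partialSum_succ_ge {q L κ lam acc m₀ : ℝ} {a : ℕ → ℝ} (hL : 0 < L) (hκ : 1 < κ)
    (hκ2 : κ ≤ 2) (hq : 2 ≤ q) (hlam : 0 < lam) (hacc : 0 < acc)
    (h : IsStepRule q L κ lam (2 ^ (2 - q)) acc m₀ a) (k : ℕ) :
    (1 + 4 ^ (-q) / max 1 ((smoothConst q L κ acc / lam) ^ rateExp q κ)) * partialSum a k ≤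
      partialSum a (k + 1) := by
  have hκ0 : 0 < κ := by linarith
  have hκq : κ ≤ q := hκ2.trans hq
  have hA := partialSum_pos h.pos k
  have hA' := partialSum_pos h.pos (k + 1)
  have hα := h.pos (k + 1)
  have hAA := partialSum_succ a k
  have hstep := h.step k
  rw [stepConst, smoothConst_mul hκ0 hκq hacc (by positivity)] at hstep
  have hB := smoothConst_pos hL hκ0 hκq hacc
  set B := smoothConst q L κ acc with hBdef
  set A := partialSum a k
  set α := a (k + 1)
  set ρ := B / lam with hρ
  have hρ0 : 0 < ρ := by positivity
  set θ := rateExp q κ with hθ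
  have hθ0 : 0 < θ := rateExp_pos hκ hq
  have hθ1 : θ ≤ 1 := rateExp_le_one hκ hq
  set g := max 1 (ρ ^ θ) with hg
  have hg1 : 1 ≤ g := le_max_left _ _
  set r := (q - κ) / κ with hr
  have hr0 : 0 ≤ r := div_nonneg (by linarith) hκ0.le
  have hrq : r ≤ q := by rw [hr, div_le_iff₀ hκ0]; nlinarith
  have hθr : θ * (q - r) = 1 := by
    have : q * κ - q + κ ≠ 0 := by nlinarith
    have e : q - r = (q * κ - q + κ) / κ := by rw [hr]; field_simp; ring
    rw [e, hθ, rateExp, div_mul_div_comm, mul_comm κ, div_self (mul_ne_zero this hκ0.ne')]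
  set s := α / A with hs
  have hs0 : 0 < s := by positivity
  suffices hsuff : 4 ^ (-q) / g ≤ s by
    rw [hAA]
    have : α = s * A := by rw [hs]; field_simp
    rw [this, add_mul, one_mul]
    gcongr
  have h4 : (4 : ℝ) ^ (-q) ≤ 1 := Real.rpow_le_one_of_one_le_of_nonpos (by norm_num) (by linarith)
  rcases le_or_gt 1 s with h1 | h1
  · exact ((div_le_one (by linarith)).2 (h4.trans hg1)).trans h1
  have hmain : 2 ^ (2 - q) * lam ≤ B * (s ^ (q - r) * (1 + s) ^ r) := by
    have e1 : (1 + s) = (A + α) / A := by rw [hs]; field_simp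
    have e2 : B * (s ^ (q - r) * (1 + s) ^ r) * A ^ q =
        α ^ q * (B * (α / (A + α)) ^ (-r)) := by
      have hAα : 0 < A + α := by linarith
      rw [e1, hs, Real.div_rpow hα.le hA.le, Real.div_rpow hAα.le hA.le, Real.rpow_neg (by positivity),
        Real.div_rpow hα.le hAα.le, Real.rpow_sub hα, Real.rpow_sub hA]
      have := (Real.rpow_pos_of_pos hα r).ne'
      have := (Real.rpow_pos_of_pos hA r).ne'
      have := (Real.rpow_pos_of_pos hA q).ne'
      have := (Real.rpow_pos_of_pos hAα r).ne'
      field_simp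
    have hAq := Real.rpow_pos_of_pos hA q
    refine le_of_mul_le_mul_right ?_ hAq
    rw [e2, hstep, hAA, div_mul_cancel₀ _ (by positivity), mul_assoc]
    gcongr
    exact le_max_left _ _
  have hpow : 2 ^ (2 - q - r) / ρ ≤ s ^ (q - r) := by
    have : (1 + s) ^ r ≤ 2 ^ r := Real.rpow_le_rpow (by linarith) (by linarith) hr0
    have h2 : 2 ^ (2 - q) * lam ≤ B * (s ^ (q - r) * 2 ^ r) := hmain.trans (by gcongr)
    rw [Real.rpow_sub (by norm_num) (2 - q) r, hρ, div_div_eq_mul_div, div_le_iff₀ hB,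
      div_mul_eq_mul_div, div_le_iff₀ (by positivity)]
    linarith
  have hroot : (2 ^ (2 - q - r) / ρ) ^ θ ≤ s := by
    calc (2 ^ (2 - q - r) / ρ) ^ θ ≤ (s ^ (q - r)) ^ θ := by gcongr
      _ = s := by rw [← Real.rpow_mul hs0.le, mul_comm, hθr, Real.rpow_one]
  refine le_trans ?_ hroot
  rw [Real.div_rpow (by positivity) hρ0.le, ← Real.rpow_mul (by norm_num)]
  have e4 : (4 : ℝ) ^ (-q) = 2 ^ (-(2 * q)) := by
    rw [show (4 : ℝ) = 2 ^ (2 : ℝ) by norm_num, ← Real.rpow_mul (by norm_num)]; congr 1; ring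
  rw [e4]
  refine div_le_div₀ (by positivity) ?_ (by positivity) (le_max_right _ _)
  refine Real.rpow_le_rpow_of_exponent_le (by norm_num) ?_
  nlinarith

lemma IsStepRule.pow_le_partialSum {q L κ lam acc m₀ : ℝ} {a : ℕ → ℝ} (hL : 0 < L) (hκ : 1 < κ)
    (hκ2 : κ ≤ 2) (hq : 2 ≤ q) (hlam : 0 < lam) (hacc : 0 < acc)
    (h : IsStepRule q L κ lam (2 ^ (2 - q)) acc m₀ a) (k : ℕ) :
    (1 + 4 ^ (-q) / max 1 ((smoothConst q L κ acc / lam) ^ rateExp q κ)) ^ k ≤ partialSum a k := by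
  induction k with
  | zero => rw [partialSum_zero, h.zero, pow_zero]
  | succ k ih =>
    refine le_trans ?_ (h.partialSum_succ_ge hL hκ hκ2 hq hlam hacc k)
    rw [pow_succ']
    gcongr

/-- Geometric growth with ratio `1 + s` reaches `T` after about `log T / s` steps. -/
lemma le_one_add_pow_of_log_le {s T : ℝ} {K : ℕ} (hs0 : 0 < s) (hs1 : s ≤ 1) (hT : 0 < T)
    (hK : 2 / s * Real.log T ≤ K) : T ≤ (1 + s) ^ K := by
  have hlog : s / 2 ≤ Real.log (1 + s) := by
    refine le_trans ?_ (Real.one_sub_inv_le_log_of_pos (by linarith))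
    have : 1 - (1 + s)⁻¹ = s / (1 + s) := by field_simp; ring
    rw [this]
    gcongr
    linarith
  rw [← Real.log_le_log_iff hT (by positivity), Real.log_pow]
  calc Real.log T = s / 2 * (2 / s * Real.log T) := by field_simp
    _ ≤ s / 2 * K := by gcongr
    _ ≤ K * Real.log (1 + s) := by rw [mul_comm]; gcongr

/-- The constant in the iteration bound. It depends on the uniform convexity exponent only. -/
noncomputable def iterConst (q : ℝ) : ℝ := 2 * 4 ^ q * Real.exp (2 * q) * (9 * q + 3) + 1

lemma iterConst_pos {q : ℝ} (hq : 2 ≤ q) : 0 < iterConst q := by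
  unfold iterConst
  have : 0 < 9 * q + 3 := by linarith
  positivity

/-- The iteration count in terms of the logarithms of the data, where `ρ` is the condition number,
`T` the weight to be reached, `z = L R ^ (κ - 1) / ε` and `P` the scale of the regularizer. When
`ρ > 1`, the factor `1 / (κ - 1)` by which `log ρ` may exceed the logarithmic factor of the bound is
contained in `rate`; when `ρ ≤ 1`, the target `T` is bounded. -/
lemma iteration_count_le {q κ z P ρ T rate : ℝ} (hκ : 1 < κ) (hκ2 : κ ≤ 2) (hq : 2 ≤ q)
    (hz : 0 < z) (hP : 0 < P) (hP1 : P ≤ 1) (hρ0 : 0 < ρ) (hrate0 : 0 < rate)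
    (hρ : Real.log ρ = Real.log (expConst q κ) - (q - κ) / κ * Real.log (κ - 1) +
      (q - 1) / (κ - 1) * Real.log (2 * z) - Real.log P)
    (hT : Real.log T = Real.log (2 * κ / q) + Real.log (expConst q κ) -
      q / κ * Real.log (κ - 1) + q / (κ - 1) * Real.log (2 * z) - Real.log P)
    (hrate : rateExp q κ * ((q - 1) / (κ - 1) * Real.log (2 * z) + q / κ * Real.log (κ / (κ - 1)) -
      Real.log P) ≤ Real.log rate) :
    2 / (4 ^ (-q) / max 1 (ρ ^ rateExp q κ)) * max 0 (Real.log T) + 1 ≤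
      iterConst q * max 1 rate * Real.log (Real.exp 1 + z / P) := by
  have hκ0 : 0 < κ := by linarith
  have hq0 : 0 < q := by linarith
  have hθ0 := rateExp_pos hκ hq
  have hθ1 := rateExp_le_one hκ hq
  have hθdef : rateExp q κ = κ / (q * κ - q + κ) := rfl
  set θ := rateExp q κ
  have hc := abs_le.1 (abs_log_expConst_le hκ hκ2 hq)
  set lc := Real.log (expConst q κ)
  have hκw : Real.log (κ / (κ - 1)) = Real.log κ - Real.log (κ - 1) :=
    Real.log_div hκ0.ne' (by linarith)
  have hlκ : 0 ≤ Real.log κ := Real.log_nonneg hκ.le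
  obtain ⟨w, hw⟩ : ∃ w, w = κ - 1 := ⟨_, rfl⟩
  rw [hκw] at hrate
  rw [← hw] at hρ hT hrate
  have hw0 : 0 < w := by linarith
  have hw1 : w ≤ 1 := by linarith
  set lw := -Real.log w with hlw
  have hlw0 : 0 ≤ lw := by rw [hlw]; linarith [Real.log_nonpos hw0.le hw1]
  have hwlw : w * lw ≤ 1 := neg_mul_log_le_one hw0
  have hlw1 : lw ≤ 1 / w := by rw [le_div_iff₀ hw0]; linarith
  set lP := -Real.log P with hlP
  have hlP0 : 0 ≤ lP := by rw [hlP]; linarith [Real.log_nonpos hP.le hP1]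
  set X := Real.log (2 * z) with hX
  set r := (q - κ) / κ with hr
  have hr1 : q / κ = r + 1 := by rw [hr]; field_simp; ring
  have hr0 : 0 ≤ r := div_nonneg (by linarith) hκ0.le
  have hrq : r ≤ q := by
    rw [hr, div_le_iff₀ hκ0]
    linarith [le_mul_of_one_le_right hq0.le hκ.le]
  set Λ := Real.log (Real.exp 1 + z / P) with hΛ
  have hzP : 0 < z / P := by positivity
  have hΛ1 : 1 ≤ Λ := by
    rw [hΛ, Real.le_log_iff_exp_le (by positivity)]; linarith
  have hΛz : Real.log z + lP ≤ Λ := by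
    have e : Real.log z + lP = Real.log (z / P) := by
      rw [Real.log_div hz.ne' hP.ne', hlP]; ring
    rw [e, hΛ]
    exact Real.log_le_log hzP (by linarith [Real.exp_pos 1])
  have hln2 : Real.log 2 ≤ 1 := by linarith [Real.log_le_sub_one_of_pos (show (0:ℝ) < 2 by norm_num)]
  have hXz : X = Real.log 2 + Real.log z := Real.log_mul (by norm_num) hz.ne'
  -- the target is at most a power of the condition number
  have hTρ : Real.log T ≤ q / (q - 1) * Real.log ρ + (3 + q) := by
    have hq1 : 0 < q - 1 := by linarith
    have h1 : Real.log (2 * κ / q) ≤ 1 := by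
      refine le_trans (Real.log_le_log (by positivity) ?_) hln2
      rw [div_le_iff₀ hq0]; linarith
    have e : Real.log T = q / (q - 1) * Real.log ρ + (Real.log (2 * κ / q) - lc / (q - 1) +
        q / (κ * (q - 1)) * (w * lw) - lP / (q - 1)) := by
      rw [hT, hρ, hr]
      have : Real.log P = -lP := by rw [hlP]; ring
      have h' : Real.log w = -lw := by rw [hlw]; ring
      rw [this, h']
      obtain rfl : κ = w + 1 := by linarith
      field_simp
      ring
    have h2 : -(lc / (q - 1)) ≤ q := by
      rw [← neg_div, div_le_iff₀ hq1]
      linarith [le_mul_of_one_le_right hq0.le (by linarith : 1 ≤ q - 1)]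
    have h3 : q / (κ * (q - 1)) * (w * lw) ≤ 2 := by
      have : q / (κ * (q - 1)) ≤ 2 := by
        rw [div_le_iff₀ (by positivity)]
        linarith [le_mul_of_one_le_left hq1.le hκ.le]
      calc q / (κ * (q - 1)) * (w * lw) ≤ 2 * 1 := by gcongr
        _ = 2 := by norm_num
    have h4 : 0 ≤ lP / (q - 1) := by positivity
    linarith
  have hiter : 2 / (4 ^ (-q) / max 1 (ρ ^ θ)) = 2 * 4 ^ q * max 1 (ρ ^ θ) := by
    rw [Real.rpow_neg (by norm_num)]
    field_simp
  rw [hiter]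
  have hmax1 : 1 ≤ max 1 rate := le_max_left _ _
  have hexp : 1 ≤ Real.exp (2 * q) := Real.one_le_exp (by positivity)
  have hmaxΛ : 1 ≤ max 1 rate * Λ := one_le_mul_of_one_le_of_one_le hmax1 hΛ1
  have hsplit : iterConst q * max 1 rate * Λ =
      2 * 4 ^ q * (Real.exp (2 * q) * (9 * q + 3) * (max 1 rate * Λ)) + max 1 rate * Λ := by
    unfold iterConst; ring
  rw [hsplit, mul_assoc]
  refine add_le_add (mul_le_mul_of_nonneg_left ?_ (by positivity)) hmaxΛ
  rcases le_or_gt ρ 1 with h1 | h1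
  · have hlρ : Real.log ρ ≤ 0 := Real.log_nonpos hρ0.le h1
    have hlT : max 0 (Real.log T) ≤ 9 * q + 3 := by
      refine max_le (by linarith) ?_
      have : q / (q - 1) * Real.log ρ ≤ 0 :=
        mul_nonpos_of_nonneg_of_nonpos (div_nonneg hq0.le (by linarith)) hlρ
      linarith
    rw [max_eq_left (Real.rpow_le_one hρ0.le h1 hθ0.le), one_mul]
    calc max 0 (Real.log T) ≤ 1 * (9 * q + 3) * 1 := by linarith
      _ ≤ _ := by gcongr
  · have hlρ0 : 0 < Real.log ρ := Real.log_pos h1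
    have hlρ : Real.log ρ ≤ 4 * q * (Λ / w) := by
      have hΛw : Λ ≤ Λ / w := le_div_self (by linarith) hw0 hw1
      have hw' : 1 / w ≤ Λ / w := by gcongr
      have b1 : lc ≤ q * (Λ / w) := hc.2.trans (le_mul_of_one_le_right hq0.le (by linarith))
      have b2 : r * lw ≤ q * (Λ / w) := by
        calc r * lw ≤ q * (1 / w) := by gcongr
          _ ≤ _ := by gcongr
      have b3 : (q - 1) / w * X + lP ≤ 2 * q * (Λ / w) := by
        have c1 : 1 ≤ (q - 1) / w := by rw [le_div_iff₀ hw0]; linarith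
        have c2 : lP ≤ (q - 1) / w * lP := le_mul_of_one_le_left hlP0 c1
        calc (q - 1) / w * X + lP ≤ (q - 1) / w * (X + lP) := by linarith
          _ ≤ (q - 1) / w * (2 * Λ) := by gcongr; linarith
          _ ≤ q / w * (2 * Λ) := by gcongr; linarith
          _ = _ := by ring
      have e : Real.log ρ = lc + r * lw + ((q - 1) / w * X + lP) := by
        rw [hρ, hlw, hlP]; ring
      linarith
    have hlT : max 0 (Real.log T) ≤ (9 * q + 3) * (Λ / w) := by
      have hΛw : 1 ≤ Λ / w := hΛ1.trans (le_div_self (by linarith) hw0 hw1)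
      refine max_le (by positivity) ?_
      have c1 : q / (q - 1) ≤ 2 := by rw [div_le_iff₀ (by linarith)]; linarith
      have c2 : q / (q - 1) * Real.log ρ ≤ 2 * Real.log ρ := by gcongr
      have c3 : (3 + q) * 1 ≤ (3 + q) * (Λ / w) := by gcongr
      linarith
    have hρrate : ρ ^ θ ≤ Real.exp (2 * q) * rate * w := by
      rw [← Real.log_le_log_iff (by positivity) (by positivity), Real.log_rpow hρ0,
        Real.log_mul (by positivity) hw0.ne', Real.log_mul (by positivity) hrate0.ne', Real.log_exp]
      have hden1 : 1 ≤ q * κ - q + κ := by linarith [le_mul_of_one_le_right hq0.le hκ.le]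
      have hden : 0 < q * κ - q + κ := by linarith
      have c1 : (1 - θ) * lw ≤ q := by
        have : 1 - θ = q * w / (q * κ - q + κ) := by
          rw [hθdef, hw, eq_div_iff hden.ne', sub_mul, div_mul_cancel₀ _ hden.ne']; ring
        rw [this, div_mul_eq_mul_div, div_le_iff₀ hden]
        have : q * w * lw ≤ q * 1 := by rw [mul_assoc]; gcongr
        linarith [mul_le_mul_of_nonneg_left hden1 hq0.le]
      have c2 : θ * lc ≤ q := by
        calc θ * lc ≤ θ * q := by gcongr; exact hc.2
          _ ≤ q := mul_le_of_le_one_left hq0.le hθ1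
      have c3 : θ * (Real.log ρ - lc + lw) ≤ Real.log rate := by
        refine le_trans ?_ hrate
        refine mul_le_mul_of_nonneg_left ?_ hθ0.le
        have c4 : 0 ≤ (r + 1) * Real.log κ := by positivity
        rw [hρ, hr1, hlw]
        linarith
      rw [hlw] at c1 c3
      linarith
    have hone : 1 ≤ ρ ^ θ := Real.one_le_rpow h1.le hθ0.le
    rw [max_eq_right hone]
    calc ρ ^ θ * max 0 (Real.log T)
        ≤ (Real.exp (2 * q) * rate * w) * ((9 * q + 3) * (Λ / w)) := by gcongr
      _ = Real.exp (2 * q) * (9 * q + 3) * (rate * Λ) := by field_simp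
      _ ≤ _ := by gcongr; exact le_max_right _ _

/-! ### The rates -/

lemma ReachesWithin.mono {d : ℕ} {p L κ ε R : ℝ} {f : (Fin d → ℝ) → ℝ} {x₀ : Fin d → ℝ}
    {N N' : ℝ} (h : ReachesWithin p L κ ε R f x₀ N) (hN : N ≤ N') :
    ReachesWithin p L κ ε R f x₀ N' := by
  refine ⟨h.1, fun x v y hr => ?_⟩
  obtain ⟨K, hK, hk⟩ := h.2 x v y hr
  exact ⟨K, hK.trans hN, hk⟩

/-- The iteration bound for both ranges of `p`, for every `rate` that dominates the effective
condition number to the power `rateExp` with its dependence on `κ - 1`. -/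
theorem reachesWithin_of_rate {d : ℕ} {p L κ ε R rate : ℝ} {f : (Fin d → ℝ) → ℝ}
    {x₀ xstar : Fin d → ℝ} (hp : 1 < p) (hL : 0 < L) (hκ : 1 < κ) (hκ2 : κ ≤ 2) (hε : 0 < ε)
    (hc : ConvexOn ℝ Set.univ f) (hf : WeaklySmooth p L κ f) (hmin : IsMinOn f Set.univ xstar)
    (hne : xstar ≠ x₀) (hR : R = lpNorm p (xstar - x₀)) (hrate0 : 0 < rate)
    (hrate : rateExp (max p 2) κ * ((max p 2 - 1) / (κ - 1) *
      Real.log (2 * (L * R ^ (κ - 1) / ε)) + max p 2 / κ * Real.log (κ / (κ - 1)) -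
      Real.log (psiScale p)) ≤ Real.log rate) :
    ReachesWithin p L κ ε R f x₀ (iterConst (max p 2) * max 1 rate *
      Real.log (Real.exp 1 + L * R ^ (κ - 1) / ε / psiScale p)) := by
  have hq := two_le_max p
  have hP := psiScale_pos hp
  have hR0 : 0 < R := by
    rw [hR]
    exact lpNorm_pos (by linarith) (sub_ne_zero.2 hne)
  have hacc := valueAcc_pos hL hκ hε
  have hlam : 0 < regParam p ε R := by rw [regParam_eq]; positivity
  have hκq := hκ2.trans hq
  have hB : 0 < smoothConst (max p 2) L κ (valueAcc L κ ε) :=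
    smoothConst_pos hL (by linarith) hκq hacc
  constructor
  · obtain ⟨m₀, a, ha⟩ := exists_isStepRule hL hκ hκ2 hq hlam hacc
    have hm : 0 < m₀ := by rw [ha.m_eq_smoothConst]; exact hB
    obtain ⟨x, v, y, hrun⟩ := exists_isRun hp hlam hm f x₀ ha.pos
    exact ⟨x, v, y, m₀, a, ha, hrun⟩
  · rintro x v y ⟨m₀, a, ha, hrun⟩
    set ρ := smoothConst (max p 2) L κ (valueAcc L κ ε) / regParam p ε R with hρdef
    have hρ0 : 0 < ρ := by positivity
    set T := 2 * smoothConst (max p 2) L κ (valueAcc L κ ε) *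
      (1 / (max p 2 * psiScale p) * R ^ max p 2) / valueAcc L κ ε with hTdef
    have hT0 : 0 < T := by positivity
    have hcount := iteration_count_le (z := L * R ^ (κ - 1) / ε) (P := psiScale p) (ρ := ρ) (T := T)
      hκ hκ2 hq (by positivity) hP (psiScale_le_one p) hρ0 hrate0
      (by rw [hρdef, regParam_eq]; exact log_condition hL hκ hκq hε hR0 hP)
      (log_target hL hκ hκq hε hR0 hP) hrate
    set s := 4 ^ (-max p 2) / max 1 (ρ ^ rateExp (max p 2) κ) with hs
    have hg : 1 ≤ max 1 (ρ ^ rateExp (max p 2) κ) := le_max_left _ _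
    have hs0 : 0 < s := by positivity
    have hs1 : s ≤ 1 := by
      rw [hs, div_le_one (by positivity)]
      exact (Real.rpow_le_one_of_one_le_of_nonpos (by norm_num) (by linarith)).trans hg
    refine ⟨⌈2 / s * max 0 (Real.log T)⌉₊,
      (Nat.ceil_lt_add_one (mul_nonneg (by positivity) (le_max_left _ _))).le.trans hcount,
      fun k hk => ?_⟩
    refine hrun.lpNorm_grad_le hp hL hκ hκ2 hε hc hf hmin hR0 hR ha ?_
    have hTA : T ≤ partialSum a k := by
      refine (le_one_add_pow_of_log_le hs0 hs1 hT0 ?_).trans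
        (ha.pow_le_partialSum hL hκ hκ2 hq hlam hacc k)
      calc 2 / s * Real.log T ≤ 2 / s * max 0 (Real.log T) := by
            gcongr; exact le_max_right _ _
        _ ≤ ⌈2 / s * max 0 (Real.log T)⌉₊ := Nat.le_ceil _
        _ ≤ k := by exact_mod_cast hk
    rw [ha.m_eq_smoothConst]
    rwa [hTdef, div_le_iff₀ hacc] at hTA

lemma rateLow_dominates {p L κ ε R : ℝ} (hp : 1 < p) (hL : 0 < L) (hκ : 1 < κ)
    (hε : 0 < ε) (hR : 0 < R) :
    0 < rateLow p L κ ε R ∧ rateExp 2 κ * ((2 - 1) / (κ - 1) *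
      Real.log (2 * (L * R ^ (κ - 1) / ε)) + 2 / κ * Real.log (κ / (κ - 1)) -
      Real.log (p - 1)) ≤ Real.log (rateLow p L κ ε R) := by
  have hκ0 : 0 < κ := by linarith
  have hw : 0 < κ - 1 := by linarith
  have hp1 : 0 < p - 1 := by linarith
  have hD : 0 < 3 * κ - 2 := by linarith
  have hpos : 0 < rateLow p L κ ε R := by unfold rateLow; positivity
  refine ⟨hpos, ?_⟩
  unfold rateLow
  rw [log_two_mul_condition hL hε hR, Real.log_mul (by positivity) (by positivity),
    Real.log_rpow (by positivity), Real.log_rpow (by positivity),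
    Real.log_mul (by positivity) (by positivity), Real.log_div (by positivity) (by positivity),
    Real.log_div (by positivity) (by positivity), Real.log_div (by positivity) (by positivity),
    Real.log_div (by positivity) (by positivity),
    Real.log_rpow hκ0, Real.log_rpow hw, Real.log_rpow hR, Real.log_rpow hp1,
    Real.log_mul (by norm_num) hL.ne', rateExp]
  have hlog : Real.log (κ - 1) ≤ Real.log κ := Real.log_le_log hw (by linarith)
  have hD' : 2 * κ - 2 + κ = 3 * κ - 2 := by ring
  rw [hD', ← sub_nonneg]
  have e : 0 ≤ (2 * (κ - 1)) / (3 * κ - 2) * (Real.log κ - Real.log (κ - 1)) :=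
    mul_nonneg (by positivity) (by linarith)
  refine e.trans_eq ?_
  have hw' := hw.ne'
  have hD'' := hD.ne'
  field_simp
  ring

lemma rateHigh_dominates {p L κ ε R : ℝ} (hp : 2 < p) (hL : 0 < L) (hκ : 1 < κ)
    (hε : 0 < ε) (hR : 0 < R) :
    0 < rateHigh p L κ ε R ∧ rateExp p κ * ((p - 1) / (κ - 1) *
      Real.log (2 * (L * R ^ (κ - 1) / ε)) + p / κ * Real.log (κ / (κ - 1)) -
      Real.log 1) ≤ Real.log (rateHigh p L κ ε R) := by
  have hκ0 : 0 < κ := by linarith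
  have hw : 0 < κ - 1 := by linarith
  have hpos : 0 < rateHigh p L κ ε R := by unfold rateHigh; positivity
  refine ⟨hpos, le_of_eq ?_⟩
  have hD : 0 < p * κ - p + κ := by nlinarith
  unfold rateHigh
  rw [show 2 * L * R ^ (κ - 1) / ε = 2 * (L * R ^ (κ - 1) / ε) by ring, Real.log_one, rateExp,
    Real.log_mul (x := (2 * (L * R ^ (κ - 1) / ε)) ^ _) (by positivity) (by positivity),
    Real.log_rpow (x := 2 * (L * R ^ (κ - 1) / ε)) (by positivity),
    Real.log_rpow (x := κ / (κ - 1)) (by positivity)]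
  generalize Real.log (2 * (L * R ^ (κ - 1) / ε)) = X
  generalize Real.log (κ / (κ - 1)) = Y
  generalize p * κ - p + κ = D at *
  have hw' := hw.ne'
  field_simp
  ring

/-- The factor lost when the rates for `κ = 2` are written without their dependence on `p`. -/
noncomputable def rateFactor (p : ℝ) : ℝ := 8 + 2 / |psiScale p|

lemma one_le_rateFactor (p : ℝ) : 1 ≤ rateFactor p := by
  unfold rateFactor
  have : 0 ≤ 2 / |psiScale p| := by positivity
  linarith

lemma max_one_mul_le {D x : ℝ} (hD : 1 ≤ D) : max 1 (D * x) ≤ D * max 1 x := by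
  rw [mul_max_of_nonneg _ _ (by linarith)]
  exact max_le_max (by linarith) le_rfl

lemma sqrt_rate_dominates {p z : ℝ} (hp : 1 < p) (hz : 0 < z) :
    0 < rateFactor p * √z ∧ rateExp 2 2 * ((2 - 1) / (2 - 1) * Real.log (2 * z) +
      2 / 2 * Real.log (2 / (2 - 1)) - Real.log (psiScale p)) ≤
        Real.log (rateFactor p * √z) := by
  have hP := psiScale_pos hp
  have hD : 0 < rateFactor p := by linarith [one_le_rateFactor p]
  have hlP : Real.log (psiScale p) ≤ 0 := Real.log_nonpos hP.le (psiScale_le_one p)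
  refine ⟨by positivity, ?_⟩
  have h1 : Real.log 2 - Real.log (psiScale p) ≤ Real.log (rateFactor p) := by
    rw [← Real.log_div (by norm_num) hP.ne']
    refine Real.log_le_log (by positivity) ?_
    unfold rateFactor
    rw [abs_of_pos hP]
    linarith
  have e : rateExp 2 2 = 1 / 2 := by unfold rateExp; norm_num
  have e2 : (2 : ℝ) / (2 - 1) = 2 := by norm_num
  rw [Real.log_mul hD.ne' (by positivity), Real.log_sqrt hz.le, e, e2,
    Real.log_mul (by norm_num) hz.ne']
  linarith

lemma rpow_rate_dominates {p z : ℝ} (hp : 2 < p) (hz : 0 < z) :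
    0 < rateFactor p * z ^ (2 * (p - 1) / (p + 2)) ∧
      rateExp p 2 * ((p - 1) / (2 - 1) * Real.log (2 * z) +
        p / 2 * Real.log (2 / (2 - 1)) - Real.log 1) ≤
          Real.log (rateFactor p * z ^ (2 * (p - 1) / (p + 2))) := by
  have hD : 0 < rateFactor p := by linarith [one_le_rateFactor p]
  refine ⟨by positivity, ?_⟩
  have hln : 0 < Real.log 2 := Real.log_pos (by norm_num)
  have h1 : 3 * Real.log 2 ≤ Real.log (rateFactor p) := by
    have : 3 * Real.log 2 = Real.log 8 := by
      rw [show (8 : ℝ) = 2 ^ 3 by norm_num, Real.log_pow]; norm_num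
    rw [this]
    refine Real.log_le_log (by norm_num) ?_
    unfold rateFactor
    have : 0 ≤ 2 / |psiScale p| := by positivity
    linarith
  have hp2 : 0 < p + 2 := by linarith
  have e : rateExp p 2 = 2 / (p + 2) := by unfold rateExp; congr 1; ring
  have e2 : (2 : ℝ) / (2 - 1) = 2 := by norm_num
  rw [Real.log_mul hD.ne' (by positivity), Real.log_rpow hz, e, e2, Real.log_one,
    Real.log_mul (by norm_num) hz.ne']
  have e3 : 2 / (p + 2) * ((p - 1) / (2 - 1) * (Real.log 2 + Real.log z) +
      p / 2 * Real.log 2 - 0) = (3 * p - 2) / (p + 2) * Real.log 2 +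
        2 * (p - 1) / (p + 2) * Real.log z := by field_simp; ring
  have h2 : (3 * p - 2) / (p + 2) * Real.log 2 ≤ 3 * Real.log 2 := by
    gcongr
    rw [div_le_iff₀ hp2]; linarith
  rw [e3]
  linarith

lemma psiScale_eq_of_le_two {p : ℝ} (hp : p ≤ 2) : psiScale p = p - 1 := min_eq_left (by linarith)

lemma psiScale_eq_of_two_lt {p : ℝ} (hp : 2 < p) : psiScale p = 1 := min_eq_right (by linarith)

end GenAGD

open GenAGD in
theorem mainTheorem3 :
    ∃ (C₀ : ℝ) (C : ℝ → ℝ), 0 < C₀ ∧ (∀ p, 0 < C p) ∧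
      ∀ (d : ℕ) (p L κ ε R : ℝ) (f : (Fin d → ℝ) → ℝ) (x₀ xstar : Fin d → ℝ),
        1 < p → 0 < L → 1 < κ → κ ≤ 2 → 0 < ε →
        ConvexOn ℝ Set.univ f → GenAGD.WeaklySmooth p L κ f →
        IsMinOn f Set.univ xstar → xstar ≠ x₀ → R = GenAGD.lpNorm p (xstar - x₀) →
        (p ≤ 2 → GenAGD.ReachesWithin p L κ ε R f x₀
          (C₀ * max 1 (GenAGD.rateLow p L κ ε R) *
            Real.log (Real.exp 1 + L * R ^ (κ - 1) / ((p - 1) * ε)))) ∧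
        (2 < p → GenAGD.ReachesWithin p L κ ε R f x₀
          (C p * max 1 (GenAGD.rateHigh p L κ ε R) *
            Real.log (Real.exp 1 + L * R ^ (κ - 1) / ε))) ∧
        (κ = 2 → p ≤ 2 → GenAGD.ReachesWithin p L κ ε R f x₀
          (C p * max 1 (Real.sqrt (L * R / ε)) *
            Real.log (Real.exp 1 + L * R / ((p - 1) * ε)))) ∧
        (κ = 2 → 2 < p → GenAGD.ReachesWithin p L κ ε R f x₀
          (C p * max 1 ((L * R / ε) ^ (2 * (p - 1) / (p + 2))) *
            Real.log (Real.exp 1 + L * R / ε))) := by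
  refine ⟨iterConst 2, fun p => iterConst (max p 2) * rateFactor p, iterConst_pos le_rfl,
    fun p => mul_pos (iterConst_pos (two_le_max p)) (by linarith [one_le_rateFactor p]), ?_⟩
  intro d p L κ ε R f x₀ xstar hp hL hκ hκ2 hε hc hf hmin hne hR
  have hR0 : 0 < R := by
    rw [hR]
    exact lpNorm_pos (by linarith) (sub_ne_zero.2 hne)
  have hP := psiScale_pos hp
  have hF := one_le_rateFactor p
  have hI := iterConst_pos (two_le_max p)
  have hlog : ∀ u : ℝ, 0 < u → 0 ≤ Real.log (Real.exp 1 + u) := fun u hu =>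
    Real.log_nonneg (by linarith [Real.add_one_le_exp 1])
  refine ⟨fun hp2 => ?_, fun hp2 => ?_, fun hκe hp2 => ?_, fun hκe hp2 => ?_⟩
  · obtain ⟨h0, h1⟩ := rateLow_dominates hp hL hκ hε hR0
    have := reachesWithin_of_rate hp hL hκ hκ2 hε hc hf hmin hne hR h0
      (by rw [max_eq_right hp2, psiScale_eq_of_le_two hp2]; exact h1)
    rwa [max_eq_right hp2, div_div, mul_comm ε, psiScale_eq_of_le_two hp2] at this
  · obtain ⟨h0, h1⟩ := rateHigh_dominates hp2 hL hκ hε hR0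
    have := reachesWithin_of_rate hp hL hκ hκ2 hε hc hf hmin hne hR h0
      (by rw [max_eq_left hp2.le, psiScale_eq_of_two_lt hp2]; exact h1)
    rw [psiScale_eq_of_two_lt hp2, div_one] at this
    refine this.mono ?_
    have := hlog (L * R ^ (κ - 1) / ε) (by positivity)
    gcongr
    exact le_mul_of_one_le_right hI.le hF
  · subst hκe
    have hz : 0 < L * R / ε := by positivity
    have hRe : R ^ ((2 : ℝ) - 1) = R := by norm_num
    obtain ⟨h0, h1⟩ := sqrt_rate_dominates hp hz
    have := reachesWithin_of_rate hp hL hκ hκ2 hε hc hf hmin hne hR h0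
      (by rw [max_eq_right hp2, hRe]; exact h1)
    rw [hRe, div_div, mul_comm ε, psiScale_eq_of_le_two hp2] at this
    refine this.mono ?_
    have hp1 : 0 < p - 1 := by linarith
    have := hlog (L * R / ((p - 1) * ε)) (by positivity)
    show _ ≤ iterConst (max p 2) * rateFactor p * _ * _
    rw [mul_assoc (iterConst _) (rateFactor p)]
    gcongr
    exact max_one_mul_le hF
  · subst hκe
    have hz : 0 < L * R / ε := by positivity
    have hRe : R ^ ((2 : ℝ) - 1) = R := by norm_num
    obtain ⟨h0, h1⟩ := rpow_rate_dominates hp2 hz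
    have := reachesWithin_of_rate hp hL hκ hκ2 hε hc hf hmin hne hR h0
      (by rw [max_eq_left hp2.le, hRe, psiScale_eq_of_two_lt hp2]; exact h1)
    rw [hRe, psiScale_eq_of_two_lt hp2, div_one] at this
    refine this.mono ?_
    have := hlog (L * R / ε) hz
    show _ ≤ iterConst (max p 2) * rateFactor p * _ * _
    rw [mul_assoc (iterConst _) (rateFactor p)]
    gcongr
    exact max_one_mul_le hF
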